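/- **Conventions.** Fix a finite field $\mathbb F_q$. An algebraic circuit over $\mathbb F_q$ is a finite directed acyclic graph whose input nodes (the nodes of in-degree $0$) are labelled by variables or scalars, whose other nodes are $+$ or $\times$ gates of unbounded fan-in (the edges into a $+$ gate carry scalar coefficients), and which has an output node. Its size is the number of nodes, its depth is the length of a longest directed path, and $\widehat C$ is the polynomial computed by $C$. An $\mathrm{IPS}^{\mathrm{alg}}$ proof of $p(\overline x)=0$ from axioms $f_1=0,\dots,f_m=0$ is an algebraic circuit $P(\overline x,y_1,\dots,y_m)$ with $\widehat P(\overline x,\overline 0)=0$ and $\widehat P(\overline x,f_1,\dots,f_m)=p$ as formal polynomials (no Boolean axioms are included). A set of equations is derived by giving one such proof for each equation; the size of the derivation is the total size of the proofs and its depth is their maximal depth. **Plain CNF.** Let $C(\overline x)$ be a circuit. A gate $g$ with operation $\circ\in\{+,\times\}$ and inputs $u_1,\dots,u_t$ is expressed, with extension variables $v^g_1,\dots,v^g_{t-2}$, by the equations $u_1\circ u_2=v^g_1$; $u_{i+2}\circ v^g_i=v^g_{i+1}$ for $1\le i\le t-3$; and $u_t\circ v^g_{t-2}=g$ (for $t=2$: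 $u_1\circ u_2=g$; for $t=1$: $u_1=g$), where for a $+$ gate each $u_i$ is multiplied by the coefficient of its edge. For each variable, gate and extension variable $u$ there are unary bits $x_{uj}$, $j\in\mathbb F_q$; the $j$-th bit of a scalar input node $\alpha$ is the constant $1$ if $j=\alpha$ and $0$ otherwise. The plain CNF encoding $\mathrm{CNF}(C(\overline x)=0)$ is the following set of equations, where a clause $\bigvee_{a\in P}a\vee\bigvee_{a\in N}\neg a$ stands for $\prod_{a\in P}(1-a)\prod_{a\in N}a=0$: 1. for each variable $x$ in $C$, the clauses $\bigvee_j x_{xj}$ and $\neg x_{xj}\vee\neg x_{xl}$ $(j\ne l)$; 2. for each of the above equations, the clauses of a CNF in the unary bits of its arguments and of its result that fails whenever two bits of the same quantity are $1$, and that, whenever the bits of the arguments encode elements of $\mathbb F_q$, is satisfied precisely when the bits of the result encode the correct value (any fixed choice of such a CNF for each operation); 3. $x_{uj}^2-x_{uj}=0$ for all unary-bit variables; 4. for the output node $o$: $x_{o0}=1$, and $x_{oj}=0$ for all $j\neq0$. **Semi-CNF.** Put $$\mathrm{UBIT}_j(z)=\frac{\prod_{i\in\mathbb F_q,\,i\ne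 j}(z-i)}{\prod_{i\in\mathbb F_q,\,i\neq j}(j-i)}.$$ The semi-CNF encoding $\mathrm{SCNF}(C(\overline x)=0)$ is obtained from $\mathrm{CNF}(C(\overline x)=0)$ by substituting $\mathrm{UBIT}_j(C_u)$ for every unary bit $x_{uj}$, where $C_u$ is the circuit computing $u$ (with $C_{v^g_i}=u_1\circ\dots\circ u_{i+1}$, coefficients included). **Theorem.** For every finite field $\mathbb F_q$ there is a constant $c$, depending only on the field, such that for every algebraic circuit $C(\overline x)$ over $\mathbb F_q$ of size $s$ and depth $\Delta$ (and every choice of the CNFs in item 2): * from $\{x^q-x=0 : x\text{ is a variable in }C\}$ and $C(\overline x)=0$ there is an $\mathrm{IPS}^{\mathrm{alg}}$ derivation of $\mathrm{SCNF}(C(\overline x)=0)$ of size at most $c\,s^c$ and depth at most $c(\Delta+1)$; * conversely, from $\{x^q-x=0 : x\text{ is a variable in }C\}$ and $\mathrm{SCNF}(C(\overline x)=0)$ there is an $\mathrm{IPS}^{\mathrm{alg}}$ derivation of $C(\overline x)=0$ of size at most $c\,s^c$ and depth at most $c(\Delta+1)$. -/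

import Mathlib

universe u v w

namespace AlgIPS

noncomputable section

open MvPolynomial

/-! ### Algebraic circuits -/

/-- The label of a node of an algebraic circuit over `F` in the variables `V`, together with its
incoming edges, which come from nodes in `N`.  The edges into an addition gate carry scalars. -/
inductive Gate (F : Type u) (V : Type v) (N : Type w) where
  | var (x : V)
  | const (a : F)
  | add (l : List (F × N))
  | mul (l : List N)

namespace Gate

variable {F : Type u} {V : Type v} {N : Type w}

/-- The incoming edges with their labels; the edges into a product gate count as labelled `1`. -/
def inputs [One F] : Gate F V N → List (F × N)
  | var _ => []
  | const _ => []
  | add l => l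
  | mul l => l.map fun u => (1, u)

/-- The node is a `+` or `×` gate (and not an input node). -/
def IsOp : Gate F V N → Prop
  | var _ => False
  | const _ => False
  | add _ => True
  | mul _ => True

/-- The operation `+` or `×` of a gate (irrelevant for input nodes). -/
def op [Add F] [Mul F] : Gate F V N → F → F → F
  | mul _ => fun x y => x * y
  | _ => fun x y => x + y

/-- The polynomial computed by a node, if its inputs compute the polynomials `f`. -/
def eval [CommSemiring F] (f : N → MvPolynomial V F) : Gate F V N → MvPolynomial V F
  | var x => X x
  | const a => MvPolynomial.C a
  | add l => (l.map fun p => MvPolynomial.C p.1 * f p.2).sum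
  | mul l => (l.map f).prod

/-- The depth of a node, if its inputs have the depths `d`. -/
def depth (d : N → ℕ) : Gate F V N → ℕ
  | var _ => 0
  | const _ => 0
  | add l => (l.map fun p => d p.2).foldr max 0 + 1
  | mul l => (l.map d).foldr max 0 + 1

end Gate

/-- Algebraic circuits: finite directed acyclic graphs (without parallel edges), with nodes listed
in a topological order, so that the edges into node `g` come from nodes with smaller numbers.
Nodes of in-degree zero are exactly the input nodes.  `size` is the number of nodes.
Nodes from which the output node cannot be reached are tolerated; they count in the size and
in the depth. -/
structure Circuit (F : Type u) [One F] (V : Type v) where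
  size : ℕ
  gate : (g : Fin size) → Gate F V (Fin g)
  out : Fin size
  inputs_ne_nil : ∀ g, (gate g).IsOp → (gate g).inputs ≠ []
  inputs_nodup : ∀ g, ((gate g).inputs.map Prod.snd).Nodup

namespace Circuit

variable {F : Type u} [Field F] {V : Type v}

/-- A node with an edge into `g`, as a node of the circuit. -/
def lift (C : Circuit F V) (g : Fin C.size) (u : Fin g) : Fin C.size := Fin.castLE g.2.le u

/-- The polynomial computed by the node `g`, that is, by the subcircuit `C_g`. -/
def val (C : Circuit F V) (g : Fin C.size) : MvPolynomial V F :=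
  (C.gate g).eval fun u => C.val (C.lift g u)
termination_by g.1
decreasing_by exact u.2

theorem val_eq (C : Circuit F V) (g : Fin C.size) :
    C.val g = (C.gate g).eval fun u => C.val (C.lift g u) := by
  rw [val]

/-- The polynomial computed by the circuit. -/
def poly (C : Circuit F V) : MvPolynomial V F := C.val C.out

/-- The length (number of edges) of the longest directed path that ends in the node `g`. -/
def nodeDepth (C : Circuit F V) (g : Fin C.size) : ℕ :=
  (C.gate g).depth fun u => C.nodeDepth (C.lift g u)
termination_by g.1
decreasing_by exact u.2

theorem nodeDepth_eq (C : Circuit F V) (g : Fin C.size) :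
    C.nodeDepth g = (C.gate g).depth fun u => C.nodeDepth (C.lift g u) := by
  rw [nodeDepth]

/-- The depth of a circuit: the length of the longest directed path. -/
def depth (C : Circuit F V) : ℕ := Finset.univ.sup C.nodeDepth

open Classical in
/-- The variables that label input nodes of `C`. -/
def vars (C : Circuit F V) : Finset V :=
  Finset.univ.biUnion fun g : Fin C.size =>
    match C.gate g with
    | .var x => {x}
    | _ => ∅

end Circuit

/-! ### The Ideal Proof System without Boolean axioms -/

section IPS

variable {F : Type u} [Field F] {V : Type v}

/-- The circuit `P` in the variables `V` and one placeholder variable for each axiom is an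
`IPS^alg` proof of `p = 0` from the axioms `f = 0`, `f ∈ A`: the polynomial computed by `P` becomes
`0` when all placeholders are set to `0`, and `p` when each placeholder is set to its axiom. -/
def IsIPSAlgProof (A : Set (MvPolynomial V F)) (p : MvPolynomial V F)
    (P : Circuit F (V ⊕ A)) : Prop :=
  aeval (Sum.elim X fun _ => (0 : MvPolynomial V F)) P.poly = 0 ∧
  aeval (Sum.elim X fun f : A => (f : MvPolynomial V F)) P.poly = p

/-- From the axioms `A` one derives all the equations `p = 0`, `p ∈ G`, by `IPS^alg` proofs of total
size at most `s`, each of depth at most `d`. -/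
def IPSAlgDerives (A : Set (MvPolynomial V F)) (G : Finset (MvPolynomial V F)) (s d : ℕ) : Prop :=
  ∃ P : MvPolynomial V F → Circuit F (V ⊕ A),
    (∀ p ∈ G, IsIPSAlgProof A p (P p) ∧ (P p).depth ≤ d) ∧ ∑ p ∈ G, (P p).size ≤ s

end IPS

/-! ### CNFs and their algebraic translation -/

/-- A CNF in the variables `α`: a finite set of clauses, each a finite set of literals; the literal
`(x, true)` is `x` and `(x, false)` is `¬ x`. -/
abbrev CNF (α : Type*) := Finset (Finset (α × Bool))

namespace CNF

/-- The assignment `ρ` satisfies the CNF `φ`. -/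
def Sat {α : Type*} (φ : CNF α) (ρ : α → Bool) : Prop :=
  ∀ c ∈ φ, ∃ l ∈ c, ρ l.1 = l.2

/-- The algebraic translation of a clause whose variables are replaced by the polynomials `b`:
the product of `1 - b x` over the positive and `b x` over the negative literals. -/
def clausePoly {α β : Type*} {F : Type u} [Field F] (b : α → MvPolynomial β F)
    (c : Finset (α × Bool)) : MvPolynomial β F :=
  ∏ l ∈ c, if l.2 then 1 - b l.1 else b l.1

open Classical in
/-- Exactly one of the variables is true. -/
def exactlyOne (α : Type*) [Fintype α] : CNF α :=
  insert (Finset.univ.image fun j => (j, true))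
    ((Finset.univ : Finset α).offDiag.image fun p => {(p.1, false), (p.2, false)})

/-- `φ` is a CNF for the equation `z = op (x₁, …, x_k)`, in the unary bits of the arguments
`x_i` (the variables `(some i, j)`, `j ∈ F`) and of `z` (the variables `(none, j)`):
if the bits of the arguments encode elements of `F`, then `φ` holds precisely when the bits of
`z` encode the value of `op`; and `φ` fails as soon as two bits of one block are set. -/
def IsTruthTable {F : Type u} {k : ℕ} (op : (Fin k → F) → F)
    (φ : CNF (Option (Fin k) × F)) : Prop :=
  (∀ (a : Fin k → F) (ρ : Option (Fin k) × F → Bool),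
    (∀ i j, ρ (some i, j) = true ↔ a i = j) →
      (φ.Sat ρ ↔ ∀ j, ρ (none, j) = true ↔ op a = j)) ∧
  (∀ (ρ : Option (Fin k) × F → Bool) (x : Option (Fin k)) (i j : F),
    i ≠ j → ρ (x, i) = true → ρ (x, j) = true → ¬ φ.Sat ρ)

end CNF

/-- A choice of truth table CNFs for the operations over `F`. -/
structure TruthTables (F : Type u) where
  cnf : {k : ℕ} → ((Fin k → F) → F) → CNF (Option (Fin k) × F)
  correct : ∀ {k : ℕ} (op : (Fin k → F) → F), CNF.IsTruthTable op (cnf op)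

open Classical in
/-- Truth table CNFs exist: exclude each wrong assignment by one clause. -/
theorem TruthTables.nonempty (F : Type u) [Fintype F] : Nonempty (TruthTables F) := by
  have key : ∀ (α : Type u) [Fintype α] (R : (α → Bool) → Prop),
      ∃ φ : CNF α, ∀ ρ, φ.Sat ρ ↔ R ρ := by
    intro α _ R
    refine ⟨(Finset.univ.filter fun τ => ¬ R τ).image
      fun τ => Finset.univ.image fun x => (x, !τ x), fun ρ => ⟨fun h => ?_, fun h c hc => ?_⟩⟩
    · by_contra hR
      obtain ⟨l, hl, hl'⟩ := h _ (Finset.mem_image_of_mem _ (by simpa using hR))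
      obtain ⟨x, -, rfl⟩ := Finset.mem_image.1 hl
      simp at hl'
    · obtain ⟨τ, hτ, rfl⟩ := Finset.mem_image.1 hc
      have hne : ρ ≠ τ := by
        rintro rfl
        simp [h] at hτ
      obtain ⟨x, hx⟩ := Function.ne_iff.1 hne
      exact ⟨(x, !τ x), Finset.mem_image_of_mem _ (Finset.mem_univ x), by
        cases h1 : ρ x <;> cases h2 : τ x <;> simp_all⟩
  have key2 : ∀ (k : ℕ) (op : (Fin k → F) → F), ∃ φ, CNF.IsTruthTable op φ := by
    intro k op
    obtain ⟨φ, hφ⟩ := key (Option (Fin k) × F) fun ρ =>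
      ∃ a : Fin k → F, (∀ i j, ρ (some i, j) = true ↔ a i = j) ∧
        ∀ j, ρ (none, j) = true ↔ op a = j
    refine ⟨φ, fun a ρ ha => ?_, fun ρ x i j hij hi hj => ?_⟩
    · rw [hφ]
      refine ⟨?_, fun h => ⟨a, ha, h⟩⟩
      rintro ⟨b, hb, h⟩
      have : b = a := funext fun i => (hb i (a i)).1 ((ha i (a i)).2 rfl)
      rwa [this] at h
    · rw [hφ]
      rintro ⟨a, ha, h⟩
      cases x with
      | none => exact hij (((h i).1 hi).symm.trans ((h j).1 hj))
      | some x => exact hij (((ha x i).1 hi).symm.trans ((ha x j).1 hj))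
  choose f hf using key2
  exact ⟨⟨fun {k} op => f k op, fun {k} op => hf k op⟩⟩

/-! ### The plain CNF and the semi-CNF encoding of a circuit equation -/

/-- The quantities of a circuit with `n` nodes that are given by unary bits: its variables, its
gates, and the extension variables of its gates. -/
inductive Quantity (V : Type v) (n : ℕ) where
  | input (x : V)
  | gate (g : Fin n)
  | ext (g : Fin n) (i : ℕ)

/-- A scalar or a quantity. -/
inductive Operand (F : Type u) (V : Type v) (n : ℕ) where
  | const (a : F)
  | quantity (x : Quantity V n)

open Classical in
/-- The `j`th unary bit of an operand: a constant for a scalar, otherwise a variable. -/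
def Operand.bit {F : Type u} [Field F] {V : Type v} {n : ℕ} (x : Operand F V n) (j : F) :
    MvPolynomial (Quantity V n × F) F :=
  match x with
  | .const a => if a = j then 1 else 0
  | .quantity y => X (y, j)

/-- An equation `res = op (arg 0, …, arg (k - 1))` between operands. -/
structure Step (F : Type u) (V : Type v) (n : ℕ) where
  {k : ℕ}
  op : (Fin k → F) → F
  arg : Fin k → Operand F V n
  res : Operand F V n

namespace Circuit

variable {F : Type u} [Field F] {V : Type v}

/-- The operand that stands for a node. -/
def operand (C : Circuit F V) (g : Fin C.size) : Operand F V C.size :=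
  match C.gate g with
  | .var x => .quantity (.input x)
  | .const a => .const a
  | .add _ => .quantity (.gate g)
  | .mul _ => .quantity (.gate g)

/-- The last equations of a gate `g`, from the extension variable number `i` on, where `(a, u) :: l`
are the inputs that are still to be processed. -/
def stepsFrom {n : ℕ} (op : F → F → F) (g : Fin n) :
    ℕ → F × Operand F V n → List (F × Operand F V n) → List (Step F V n)
  | i, (a, u), [] =>
    [⟨fun x => op (a * x 0) (x 1), ![u, .quantity (.ext g i)], .quantity (.gate g)⟩]
  | i, (a, u), b :: l =>
    ⟨fun x => op (a * x 0) (x 1), ![u, .quantity (.ext g i)], .quantity (.ext g (i + 1))⟩ ::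
      stepsFrom op g (i + 1) b l

/-- The equations of a gate `g` with operation `∘` and inputs `u₁, …, u_t`, namely
`u₁ ∘ u₂ = v₁`, then `u_{i+2} ∘ v_i = v_{i+1}` for `1 ≤ i ≤ t - 3`, and `u_t ∘ v_{t-2} = g`; here
every `u_i` is multiplied by the label of its edge, and `v_{i+1}` is the extension variable
`ext g i`.  For `t = 2` this is `u₁ ∘ u₂ = g` and for `t = 1` it is `u₁ = g`. -/
def stepsOf {n : ℕ} (op : F → F → F) (g : Fin n) :
    List (F × Operand F V n) → List (Step F V n)
  | [] => []
  | [(a, u)] => [⟨fun x : Fin 1 → F => a * x 0, ![u], .quantity (.gate g)⟩]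
  | [(a, u), (b, v)] =>
    [⟨fun x => op (a * x 0) (b * x 1), ![u, v], .quantity (.gate g)⟩]
  | (a, u) :: (b, v) :: c :: l =>
    ⟨fun x => op (a * x 0) (b * x 1), ![u, v], .quantity (.ext g 0)⟩ :: stepsFrom op g 0 c l

/-- The equations of the node `g` of `C` (none if `g` is an input node). -/
def steps (C : Circuit F V) (g : Fin C.size) : List (Step F V C.size) :=
  stepsOf (C.gate g).op g
    ((C.gate g).inputs.map fun p => (p.1, C.operand (C.lift g p.2)))

open Classical in
/-- The quantities of `C`; a gate with `t` inputs has `t - 2` extension variables (none if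
`t ≤ 2`). -/
def quantities (C : Circuit F V) : Finset (Quantity V C.size) :=
  C.vars.image .input ∪
  (Finset.univ.filter fun g => (C.gate g).IsOp).image .gate ∪
  Finset.univ.biUnion fun g =>
    (Finset.range ((C.gate g).inputs.length - 2)).image (.ext g)

open Classical in
/-- The plain CNF encoding of the circuit equation `C = 0`, as a set of polynomial equations
`p = 0` in the unary bits: the bits of each variable encode exactly one element;
the truth table CNFs of all equations of gates; the Boolean axioms of all unary bits;
and the bits of the output node encode `0`. -/
def cnf [Fintype F] (C : Circuit F V) (T : TruthTables F) :
    Finset (MvPolynomial (Quantity V C.size × F) F) :=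
  (C.vars.biUnion fun x =>
    (CNF.exactlyOne F).image (CNF.clausePoly fun j => X (.input x, j))) ∪
  (Finset.univ.biUnion fun g =>
    (C.steps g).toFinset.biUnion fun s =>
      (T.cnf s.op).image (CNF.clausePoly fun y =>
        (match y.1 with
          | some i => s.arg i
          | none => s.res).bit y.2)) ∪
  ((C.quantities ×ˢ Finset.univ).image fun y => X y ^ 2 - X y) ∪
  insert ((C.operand C.out).bit 0 - 1)
    ((Finset.univ.erase 0).image fun j => (C.operand C.out).bit j)

/-- The polynomial computed by the subcircuit `C_u` of a quantity `u`: the extension variable `v_i`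
of a gate combines the first `i + 1` inputs of the gate. -/
def quantityPoly (C : Circuit F V) : Quantity V C.size → MvPolynomial V F
  | .input x => X x
  | .gate g => C.val g
  | .ext g i =>
    match C.gate g with
    | .var _ => 0
    | .const _ => 0
    | .add l =>
      ((l.take (i + 2)).map fun p => MvPolynomial.C p.1 * C.val (C.lift g p.2)).sum
    | .mul l => ((l.take (i + 2)).map fun u => C.val (C.lift g u)).prod

open Classical in
/-- The Lagrange polynomial `UBIT_j(p) = ∏_{i ≠ j} (p - i) / ∏_{i ≠ j} (j - i)`. -/
def ubit [Fintype F] (j : F) (p : MvPolynomial V F) : MvPolynomial V F :=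
  MvPolynomial.C (∏ i ∈ Finset.univ.erase j, (j - i))⁻¹ *
    ∏ i ∈ Finset.univ.erase j, (p - MvPolynomial.C i)

open Classical in
/-- The semi-CNF encoding of `C = 0`: the plain CNF encoding with `UBIT_j(C_u)` substituted for the
unary bit `(u, j)`. -/
def scnf [Fintype F] (C : Circuit F V) (T : TruthTables F) : Finset (MvPolynomial V F) :=
  (C.cnf T).image (aeval fun y => ubit y.2 (C.quantityPoly y.1))

/-- The field axioms `x^q - x = 0` of the variables `x` of `C`. -/
def fieldAxioms [Fintype F] (C : Circuit F V) : Set (MvPolynomial V F) :=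
  {p | ∃ x ∈ C.vars, p = X x ^ Fintype.card F - X x}

end Circuit

end

end AlgIPS

/-! The key is a cheap proof of `p ^ q - p = 0` for every polynomial `p` computed inside `C`. Let
`y_x` be the placeholder of the axiom `x ^ q - x`. The circuit for `p(x + y) - p(x)` vanishes at `y
= 0`. At `y = x ^ q - x` it becomes `p(x ^ q) - p(x)`, which equals `p ^ q - p` because Frobenius
fixes the coefficients. Two substituted copies of `C` suffice, and no polynomial is expanded
(`exists_provable_aeval`).

A fixed polynomial `G` in `k` variables that vanishes on all of `F ^ k` lies in the ideal generated
by the `X_i ^ q - X_i`, by the combinatorial Nullstellensatz. So `G(p_1, ..., p_k) = ∑ h_i(p) (p_i ^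
q - p_i)` has a short proof, with overhead depending on `G` only
(`exists_provable_of_eval_eq_zero`).

Apart from the output bits, each equation of the semi-CNF is such a `G` at operands of `C`. A
translated clause vanishes at every point because the Lagrange polynomials give genuine unary bits,
and the result of a step is the correct value by construction. Extension variables keep the arity at
most two, and there are finitely many edge labels and clauses, so finitely many `G` occur and one
constant serves them all, whatever CNFs were chosen.

For the output, `UBIT_j(z)` minus its value at `0` is a polynomial in `z` without constant term, so
the axiom `C = 0` yields its vanishing. Conversely, if `c` is the leading coefficient of `UBIT_0`,
then `c (z ^ q - z) = z UBIT_0(z)`, and hence `z = -z (UBIT_0(z) - 1) + c (z ^ q - z)`. -/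

namespace AlgIPS

noncomputable section

open MvPolynomial

/-! ### Appending a node to a circuit. -/

namespace Gate

variable {F : Type u} {V : Type v} {N : Type w} {M : Type*}

/-- Rename the nodes from which the incoming edges of a gate come. -/
def mapNode (f : N → M) : Gate F V N → Gate F V M
  | var x => var x
  | const a => const a
  | add l => add (l.map fun p => (p.1, f p.2))
  | mul l => mul (l.map f)

theorem isOp_mapNode (f : N → M) (G : Gate F V N) : (G.mapNode f).IsOp ↔ G.IsOp := by
  cases G <;> rfl

theorem inputs_mapNode [One F] (f : N → M) (G : Gate F V N) :
    (G.mapNode f).inputs = G.inputs.map fun p => (p.1, f p.2) := by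
  cases G <;> simp [mapNode, inputs]

theorem eval_mapNode [CommSemiring F] (f : N → M) (G : Gate F V N)
    (v : M → MvPolynomial V F) : (G.mapNode f).eval v = G.eval fun u => v (f u) := by
  cases G <;> simp [mapNode, eval, Function.comp_def]

theorem depth_mapNode (f : N → M) (G : Gate F V N) (d : M → ℕ) :
    (G.mapNode f).depth d = G.depth fun u => d (f u) := by
  cases G <;> simp [mapNode, depth, Function.comp_def]

end Gate

theorem foldr_max_le_iff {l : List ℕ} {d : ℕ} : l.foldr max 0 ≤ d ↔ ∀ x ∈ l, x ≤ d := by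
  induction l with
  | nil => simp
  | cons a l ih => simp [ih]

namespace Circuit

variable {F : Type u} [Field F] {V : Type v}

/-- Parallel edges are excluded, so the in-degree is at most the number of nodes. Without this the
size would not control the number of edges and of extension variables. -/
theorem inputs_length_le (C : Circuit F V) (g : Fin C.size) :
    (C.gate g).inputs.length ≤ C.size := by
  have h := (C.inputs_nodup g).length_le_card
  rw [List.length_map, Fintype.card_fin] at h
  exact h.trans g.2.le

theorem size_pos (C : Circuit F V) : 0 < C.size := C.out.pos

theorem nodeDepth_le_depth (C : Circuit F V) (g : Fin C.size) : C.nodeDepth g ≤ C.depth :=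
  Finset.le_sup (f := C.nodeDepth) (Finset.mem_univ g)

/-- The circuit with a single constant node. -/
def single (a : F) : Circuit F V where
  size := 1
  gate _ := .const a
  out := 0
  inputs_ne_nil _ h := h.elim
  inputs_nodup _ := List.nodup_nil

/-- Append a node to a circuit. -/
def snoc (C : Circuit F V) (G : Gate F V (Fin C.size)) (h₁ : G.IsOp → G.inputs ≠ [])
    (h₂ : (G.inputs.map Prod.snd).Nodup) : Circuit F V where
  size := C.size + 1
  gate g := if h : g.1 < C.size then C.gate ⟨g.1, h⟩ else G.mapNode (Fin.castLE (not_lt.1 h))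
  out := Fin.last _
  inputs_ne_nil g := by
    by_cases h : g.1 < C.size
    · rw [dif_pos h]
      exact C.inputs_ne_nil ⟨g.1, h⟩
    · rw [dif_neg h, Gate.isOp_mapNode, Gate.inputs_mapNode]
      simpa using h₁
  inputs_nodup g := by
    by_cases h : g.1 < C.size
    · rw [dif_pos h]
      exact C.inputs_nodup ⟨g.1, h⟩
    · rw [dif_neg h, Gate.inputs_mapNode, List.map_map]
      have := h₂.map (Fin.castLE_injective (not_lt.1 h))
      rwa [List.map_map] at this

section snoc

variable (C : Circuit F V) (G : Gate F V (Fin C.size)) (h₁ : G.IsOp → G.inputs ≠ [])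
    (h₂ : (G.inputs.map Prod.snd).Nodup)

/-- An old node of an extended circuit. -/
def snocOld (g : Fin C.size) : Fin (C.snoc G h₁ h₂).size := Fin.castSucc g

/-- The new node of an extended circuit. -/
def snocNew : Fin (C.snoc G h₁ h₂).size := Fin.last C.size

theorem snocOld_injective : Function.Injective (C.snocOld G h₁ h₂) := Fin.castSucc_injective _

theorem snocOld_ne_snocNew (g : Fin C.size) : C.snocOld G h₁ h₂ g ≠ C.snocNew G h₁ h₂ :=
  Fin.castSucc_ne_last g

theorem forall_snoc {p : Fin (C.snoc G h₁ h₂).size → Prop} (hnew : p (C.snocNew G h₁ h₂))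
    (hold : ∀ g, p (C.snocOld G h₁ h₂ g)) (g) : p g :=
  Fin.lastCases (motive := p) hnew hold g

theorem snoc_gate_old (g : Fin C.size) :
    (C.snoc G h₁ h₂).gate (C.snocOld G h₁ h₂ g) = C.gate g := dif_pos g.2

theorem snoc_gate_new :
    (C.snoc G h₁ h₂).gate (C.snocNew G h₁ h₂) =
      G.mapNode (Fin.castLE (show C.size ≤ (C.snocNew G h₁ h₂).1 from le_rfl)) :=
  dif_neg (lt_irrefl _)

theorem val_snocOld (g : Fin C.size) :
    (C.snoc G h₁ h₂).val (C.snocOld G h₁ h₂ g) = C.val g := by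
  obtain ⟨n, hn⟩ := g
  induction n using Nat.strong_induction_on with
  | _ n ih =>
    rw [val_eq, val_eq C, snoc_gate_old]
    exact congrArg (fun f => Gate.eval f (C.gate ⟨n, hn⟩)) (funext fun u => ih u.1 u.2 _)

theorem nodeDepth_snocOld (g : Fin C.size) :
    (C.snoc G h₁ h₂).nodeDepth (C.snocOld G h₁ h₂ g) = C.nodeDepth g := by
  obtain ⟨n, hn⟩ := g
  induction n using Nat.strong_induction_on with
  | _ n ih =>
    rw [nodeDepth_eq, nodeDepth_eq C, snoc_gate_old]
    exact congrArg (fun f => Gate.depth f (C.gate ⟨n, hn⟩)) (funext fun u => ih u.1 u.2 _)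

theorem val_snocNew : (C.snoc G h₁ h₂).val (C.snocNew G h₁ h₂) = G.eval C.val := by
  rw [val_eq, snoc_gate_new, Gate.eval_mapNode]
  exact congrArg (fun f => Gate.eval f G) (funext fun u => val_snocOld C G h₁ h₂ u)

theorem nodeDepth_snocNew :
    (C.snoc G h₁ h₂).nodeDepth (C.snocNew G h₁ h₂) = G.depth C.nodeDepth := by
  rw [nodeDepth_eq, snoc_gate_new, Gate.depth_mapNode]
  exact congrArg (fun f => Gate.depth f G) (funext fun u => nodeDepth_snocOld C G h₁ h₂ u)

end snoc

end Circuit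

/-! ### Building circuits step by step, with only polynomials and depths recorded. -/

section Realizes

variable {F : Type u} [Field F] {V : Type v}

/-- Some circuit of size at most `N` and depth at most `D` has, for every `(p, d) ∈ S`, a node of
depth at most `d` that computes `p`, and moreover pairwise distinct nodes of depth at most `e` that
compute the entries of the list `ps`. -/
def RealizesList (N D : ℕ) (S : Set (MvPolynomial V F × ℕ)) (ps : List (MvPolynomial V F))
    (e : ℕ) : Prop :=
  ∃ C : Circuit F V, C.size ≤ N ∧ (∀ g, C.nodeDepth g ≤ D) ∧
    (∀ p ∈ S, ∃ g, C.val g = p.1 ∧ C.nodeDepth g ≤ p.2) ∧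
    ∃ us : List (Fin C.size), us.Nodup ∧ us.map C.val = ps ∧ ∀ u ∈ us, C.nodeDepth u ≤ e

/-- Some circuit of size at most `N` and depth at most `D` has, for every `(p, d) ∈ S`, a node of
depth at most `d` that computes `p`. -/
def Realizes (N D : ℕ) (S : Set (MvPolynomial V F × ℕ)) : Prop :=
  ∃ C : Circuit F V, C.size ≤ N ∧ (∀ g, C.nodeDepth g ≤ D) ∧
    ∀ p ∈ S, ∃ g, C.val g = p.1 ∧ C.nodeDepth g ≤ p.2

variable {N D : ℕ} {S : Set (MvPolynomial V F × ℕ)}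

theorem Realizes.mono {N' D' : ℕ} {S' : Set (MvPolynomial V F × ℕ)} (h : Realizes N D S)
    (hN : N ≤ N') (hD : D ≤ D') (hS : S' ⊆ S) : Realizes N' D' S' := by
  obtain ⟨C, h₁, h₂, h₃⟩ := h
  exact ⟨C, h₁.trans hN, fun g => (h₂ g).trans hD, fun p hp => h₃ p (hS hp)⟩

theorem realizes_empty (D : ℕ) : Realizes 1 D (∅ : Set (MvPolynomial V F × ℕ)) := by
  refine ⟨.single 0, le_rfl, fun g => ?_, by simp⟩
  rw [Circuit.nodeDepth_eq]
  exact Nat.zero_le _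

/-- A realized polynomial is computed by a circuit. -/
theorem Realizes.exists_circuit (h : Realizes N D S) {p : MvPolynomial V F} {d : ℕ}
    (hp : (p, d) ∈ S) : ∃ C : Circuit F V, C.poly = p ∧ C.size ≤ N ∧ C.depth ≤ D := by
  obtain ⟨C, h₁, h₂, h₃⟩ := h
  obtain ⟨g, hg, -⟩ := h₃ _ hp
  -- Only the output node is moved. The depth of a circuit is taken over all its nodes, so it is
  -- bounded by `D` and not by `d`.
  refine ⟨⟨C.size, C.gate, g, C.inputs_ne_nil, C.inputs_nodup⟩, ?_, h₁,
    Finset.sup_le fun u _ => ?_⟩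
  · have key : ∀ u : Fin C.size,
        (⟨C.size, C.gate, g, C.inputs_ne_nil, C.inputs_nodup⟩ : Circuit F V).val u = C.val u := by
      rintro ⟨n, hn⟩
      induction n using Nat.strong_induction_on with
      | _ n ih =>
        rw [Circuit.val_eq, Circuit.val_eq C]
        congr 1
        funext u
        exact ih u.1 u.2 _
    exact (key g).trans hg
  · have key : ∀ u : Fin C.size,
        (⟨C.size, C.gate, g, C.inputs_ne_nil, C.inputs_nodup⟩ : Circuit F V).nodeDepth u =
          C.nodeDepth u := by
      rintro ⟨n, hn⟩
      induction n using Nat.strong_induction_on with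
      | _ n ih =>
        rw [Circuit.nodeDepth_eq, Circuit.nodeDepth_eq C]
        congr 1
        funext u
        exact ih u.1 u.2 _
    exact (key u).trans_le (h₂ u)

/-- Append a node to the circuit behind `Realizes`. -/
theorem Circuit.realizes_snoc (C : Circuit F V) (hN : C.size ≤ N)
    (hD : ∀ g, C.nodeDepth g ≤ D) (hS : ∀ p ∈ S, ∃ g, C.val g = p.1 ∧ C.nodeDepth g ≤ p.2)
    (G : Gate F V (Fin C.size)) (h₁ : G.IsOp → G.inputs ≠ [])
    (h₂ : (G.inputs.map Prod.snd).Nodup) {d : ℕ} (hd : G.depth C.nodeDepth ≤ d) (hdD : d ≤ D) :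
    Realizes (N + 1) D (insert (G.eval C.val, d) S) := by
  refine ⟨C.snoc G h₁ h₂, Nat.add_le_add_right hN 1, fun g => ?_, ?_⟩
  · refine C.forall_snoc _ _ _ (p := fun g => Circuit.nodeDepth _ g ≤ D) ?_ (fun g => ?_) g
    · rw [nodeDepth_snocNew]
      exact hd.trans hdD
    · rw [nodeDepth_snocOld]
      exact hD g
  · rintro p (rfl | hp)
    · exact ⟨C.snocNew _ _ _, val_snocNew .., by rw [nodeDepth_snocNew]; exact hd⟩
    · obtain ⟨g, hg, hg'⟩ := hS p hp
      exact ⟨C.snocOld _ _ _ g, by rw [val_snocOld, hg], by rwa [nodeDepth_snocOld]⟩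

theorem Realizes.insert_of_le (h : Realizes N D S) {p : MvPolynomial V F} {d d' : ℕ}
    (hp : (p, d) ∈ S) (hd : d ≤ d') : Realizes N D (insert (p, d') S) := by
  obtain ⟨C, h₁, h₂, h₃⟩ := h
  refine ⟨C, h₁, h₂, ?_⟩
  rintro q (rfl | hq)
  · obtain ⟨g, hg, hg'⟩ := h₃ _ hp
    exact ⟨g, hg, hg'.trans hd⟩
  · exact h₃ q hq

/-- Realize a finite family of polynomials, one after the other. -/
theorem Realizes.insert_family {ι : Type*} (h : Realizes N D S) (s : Finset ι)
    (f : ι → MvPolynomial V F) (d k : ℕ)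
    (hf : ∀ i ∈ s, ∀ N' S', S ⊆ S' → Realizes N' D S' → Realizes (N' + k) D (insert (f i, d) S')) :
    Realizes (N + k * s.card) D (S ∪ {p | ∃ i ∈ s, p = (f i, d)}) := by
  classical
  induction s using Finset.induction_on with
  | empty => exact h.mono (by simp) le_rfl (by simp)
  | insert a s ha ih =>
    have := hf a (Finset.mem_insert_self a s) _ _ Set.subset_union_left
      (ih fun i hi => hf i (Finset.mem_insert_of_mem hi))
    refine this.mono (by rw [Finset.card_insert_of_notMem ha]; ring_nf; rfl) le_rfl ?_
    rintro p (hp | ⟨i, hi, rfl⟩)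
    · exact Or.inr (Or.inl hp)
    · rcases Finset.mem_insert.1 hi with rfl | hi
      · exact Or.inl rfl
      · exact Or.inr (Or.inr ⟨i, hi, rfl⟩)

theorem Realizes.insert_X (h : Realizes N D S) (x : V) (d : ℕ) (hd : d ≤ D) :
    Realizes (N + 1) D (insert (X x, d) S) := by
  obtain ⟨C, h₁, h₂, h₃⟩ := h
  exact C.realizes_snoc h₁ h₂ h₃ (.var x) (fun h => h.elim) List.nodup_nil (Nat.zero_le _) hd

theorem Realizes.insert_C (h : Realizes N D S) (a : F) (d : ℕ) (hd : d ≤ D) :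
    Realizes (N + 1) D (insert (C a, d) S) := by
  obtain ⟨C, h₁, h₂, h₃⟩ := h
  exact C.realizes_snoc h₁ h₂ h₃ (.const a) (fun h => h.elim) List.nodup_nil (Nat.zero_le _) hd

/-- Copies of realized polynomials at pairwise distinct nodes. -/
theorem Realizes.list (h : Realizes N D S) {d : ℕ} (hd : d + 1 ≤ D)
    (ps : List (MvPolynomial V F)) (hps : ∀ p ∈ ps, ∃ d' ≤ d, (p, d') ∈ S) :
    RealizesList (N + ps.length) D S ps (d + 1) := by
  induction ps with
  | nil =>
    obtain ⟨C, h₁, h₂, h₃⟩ := h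
    exact ⟨C, h₁, h₂, h₃, [], List.nodup_nil, rfl, by simp⟩
  | cons p ps ih =>
    obtain ⟨C, h₁, h₂, h₃, us, h₄, h₅, h₆⟩ := ih fun q hq => hps q (List.mem_cons_of_mem _ hq)
    obtain ⟨d', hd', hp⟩ := hps p List.mem_cons_self
    obtain ⟨g, hg, hg'⟩ := h₃ _ hp
    replace hg' := hg'.trans hd'
    -- A product gate with a single input copies a node, at the price of one level.
    let G : Gate F V (Fin C.size) := .mul [g]
    have hG₁ : G.IsOp → G.inputs ≠ [] := fun _ => by simp [G, Gate.inputs]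
    have hG₂ : (G.inputs.map Prod.snd).Nodup := by simp [G, Gate.inputs]
    have hG₃ : G.depth C.nodeDepth ≤ d + 1 := by
      simpa [G, Gate.depth] using hg'
    refine ⟨C.snoc G hG₁ hG₂, by simpa [Circuit.snoc, ← add_assoc] using h₁, fun g => ?_,
      fun p hp => ?_, C.snocNew _ _ _ :: us.map (C.snocOld _ _ _), ?_, ?_, ?_⟩
    · refine C.forall_snoc _ _ _ (p := fun g => Circuit.nodeDepth _ g ≤ D) ?_ (fun g => ?_) g
      · rw [Circuit.nodeDepth_snocNew]
        exact hG₃.trans hd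
      · rw [Circuit.nodeDepth_snocOld]
        exact h₂ g
    · obtain ⟨g, hg, hg'⟩ := h₃ p hp
      exact ⟨C.snocOld _ _ _ g, by rw [Circuit.val_snocOld, hg],
        by rwa [Circuit.nodeDepth_snocOld]⟩
    · rw [List.nodup_cons]
      refine ⟨?_, h₄.map (C.snocOld_injective _ _ _)⟩
      simp [C.snocOld_ne_snocNew]
    · rw [List.map_cons, List.map_map, Circuit.val_snocNew, ← h₅]
      congr 1
      · simp [G, Gate.eval, hg]
      · exact List.map_congr_left fun u _ => Circuit.val_snocOld ..
    · intro u hu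
      rcases List.mem_cons.1 hu with rfl | hu
      · rw [Circuit.nodeDepth_snocNew]
        exact hG₃
      · obtain ⟨v, hv, rfl⟩ := List.mem_map.1 hu
        rw [Circuit.nodeDepth_snocOld]
        exact h₆ v hv

/-- Factors may repeat, or be realized at one and the same node, while parallel edges are forbidden.
Hence every factor is copied first: one extra node per factor, and two levels instead of one. The
same holds for sums. -/
theorem Realizes.insert_prod (h : Realizes N D S) {d : ℕ} (hd : d + 2 ≤ D)
    (ps : List (MvPolynomial V F)) (hps : ∀ p ∈ ps, ∃ d' ≤ d, (p, d') ∈ S) :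
    Realizes (N + (ps.length + 1)) D (insert (ps.prod, d + 2) S) := by
  rcases ps.eq_nil_or_concat with rfl | hne
  -- Gates need at least one input, so the empty product is a scalar node.
  · simpa using h.insert_C 1 (d + 2) hd
  have hne : ps ≠ [] := by
    obtain ⟨_, _, rfl⟩ := hne
    simp
  obtain ⟨C, h₁, h₂, h₃, us, h₄, h₅, h₆⟩ := h.list (by omega) ps hps
  have := C.realizes_snoc h₁ h₂ h₃ (.mul us) (d := d + 2)
    (fun _ => by
      rintro h
      simp only [Gate.inputs, List.map_eq_nil_iff] at h
      simp only [h, List.map_nil] at h₅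
      exact hne h₅.symm)
    (by simpa [Gate.inputs, Function.comp_def] using h₄)
    (by
      simp only [Gate.depth, Nat.add_le_add_iff_right, foldr_max_le_iff, List.mem_map]
      rintro _ ⟨u, hu, rfl⟩
      exact h₆ u hu) hd
  rwa [Gate.eval, h₅] at this

theorem Realizes.insert_sum (h : Realizes N D S) {d : ℕ} (hd : d + 2 ≤ D)
    (l : List (F × MvPolynomial V F)) (hl : ∀ p ∈ l, ∃ d' ≤ d, (p.2, d') ∈ S) :
    Realizes (N + (l.length + 1)) D (insert ((l.map fun p => C p.1 * p.2).sum, d + 2) S) := by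
  by_cases hne : l = []
  · subst hne
    simpa using h.insert_C 0 (d + 2) hd
  obtain ⟨C, h₁, h₂, h₃, us, h₄, h₅, h₆⟩ := h.list (d := d) (by omega) (l.map Prod.snd) (by
    intro p hp
    obtain ⟨x, hx, rfl⟩ := List.mem_map.1 hp
    exact hl x hx)
  rw [List.length_map] at h₁
  have hlen : us.length = l.length := by simpa using congrArg List.length h₅
  have hsnd : ((l.map Prod.fst).zip us).map Prod.snd = us :=
    List.map_snd_zip (by simp [hlen])
  have := C.realizes_snoc h₁ h₂ h₃ (.add ((l.map Prod.fst).zip us)) (d := d + 2)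
    (fun _ => by
      rintro h
      simp only [Gate.inputs] at h
      rw [h] at hsnd
      rw [← hsnd] at hlen
      exact hne (List.length_eq_zero_iff.1 hlen.symm))
    (by simpa only [Gate.inputs, hsnd] using h₄)
    (by
      simp only [Gate.depth, Nat.add_le_add_iff_right, foldr_max_le_iff, List.mem_map]
      rintro _ ⟨p, hp, rfl⟩
      exact h₆ _ (List.of_mem_zip hp).2) hd
  have hval : ((l.map Prod.fst).zip us).map (fun p => MvPolynomial.C p.1 * C.val p.2) =
      l.map fun p => MvPolynomial.C p.1 * p.2 := by
    have : ((l.map Prod.fst).zip us).map (Prod.map id C.val) = l := by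
      rw [← List.zip_map_right, h₅]
      exact (List.zip_of_prod rfl rfl).symm
    conv_rhs => rw [← this]
    simp [Function.comp_def]
  rwa [Gate.eval, hval] at this

end Realizes

/-! ### Substitution instances of circuits and of fixed polynomials. -/

section Subst

variable {F : Type u} [Field F] {V : Type v} {W : Type w} {N D : ℕ}
  {S : Set (MvPolynomial W F × ℕ)}

/-- Realize a substitution instance of the polynomial computed by a gate. -/
theorem Realizes.insert_gate {ν : Type*} (h : Realizes N D S) (θ : V → MvPolynomial W F) (e : ℕ)
    (G : Gate F V ν) (f : ν → MvPolynomial V F) (d : ν → ℕ)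
    (hvar : ∀ x, G = .var x → (θ x, e) ∈ S)
    (hf : ∀ u, (aeval θ (f u), e + 2 * d u) ∈ S) (hD : e + 2 * G.depth d ≤ D) :
    Realizes (N + (G.inputs.length + 1)) D
      (insert (aeval θ (G.eval f), e + 2 * G.depth d) S) := by
  cases G with
  | var x =>
    -- The substituted polynomial is already realized, and no node is appended.
    refine h.mono (Nat.le_add_right _ _) le_rfl (Set.insert_subset ?_ subset_rfl)
    simpa [Gate.eval, Gate.depth] using hvar x rfl
  | const a =>
    simpa [Gate.eval, Gate.depth, Gate.inputs, algebraMap_eq] using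
      h.insert_C a (e + 2 * 0) hD
  | add l =>
    have := h.insert_sum (d := e + 2 * (l.map fun p => d p.2).foldr max 0)
      (by simpa [Gate.depth, mul_add, add_assoc] using hD)
      (l.map fun p => (p.1, aeval θ (f p.2))) (by
        intro p hp
        obtain ⟨q, hq, rfl⟩ := List.mem_map.1 hp
        refine ⟨_, ?_, hf q.2⟩
        have := foldr_max_le_iff.1 (le_refl ((l.map fun p => d p.2).foldr max 0)) (d q.2)
          (List.mem_map_of_mem (f := fun p => d p.2) hq)
        omega)
    simpa [Gate.eval, Gate.depth, Gate.inputs, map_list_sum, Function.comp_def, mul_add,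
      add_assoc, algebraMap_eq] using this
  | mul l =>
    have := h.insert_prod (d := e + 2 * (l.map d).foldr max 0)
      (by simpa [Gate.depth, mul_add, add_assoc] using hD)
      (l.map fun p => aeval θ (f p)) (by
        intro p hp
        obtain ⟨q, hq, rfl⟩ := List.mem_map.1 hp
        refine ⟨_, ?_, hf q⟩
        have := foldr_max_le_iff.1 (le_refl ((l.map d).foldr max 0)) (d q)
          (List.mem_map_of_mem hq)
        omega)
    simpa [Gate.eval, Gate.depth, Gate.inputs, map_list_prod, Function.comp_def, mul_add,
      add_assoc] using this

namespace Circuit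

theorem mem_vars (C : Circuit F V) {g : Fin C.size} {x : V} (h : C.gate g = .var x) :
    x ∈ C.vars := by
  classical
  rw [vars, Finset.mem_biUnion]
  exact ⟨g, Finset.mem_univ g, by simp [h]⟩

theorem card_vars_le (C : Circuit F V) : C.vars.card ≤ C.size := by
  classical
  rw [vars]
  refine (Finset.card_biUnion_le_card_mul _ _ 1 fun g _ => ?_).trans (by simp)
  split <;> simp

/-- A circuit realizes its substitution instances. -/
theorem realizes_subst (C : Circuit F V) (h : Realizes N D S) (θ : V → MvPolynomial W F) (e : ℕ)
    (hθ : ∀ x ∈ C.vars, (θ x, e) ∈ S) (hD : e + 2 * C.depth ≤ D) :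
    Realizes (N + C.size * (C.size + 1)) D
      (S ∪ Set.range fun g => (aeval θ (C.val g), e + 2 * C.nodeDepth g)) := by
  -- Induction along the topological order. A node costs its in-degree plus one, and each level of
  -- `C` becomes two because of the copies.
  have key : ∀ k ≤ C.size, Realizes (N + k * (C.size + 1)) D
      (S ∪ {p | ∃ g, g.1 < k ∧ p = (aeval θ (C.val g), e + 2 * C.nodeDepth g)}) := by
    intro k hk
    induction k with
    | zero => exact h.mono (by simp) le_rfl (by simp)
    | succ k ih =>
      let g : Fin C.size := ⟨k, hk⟩
      have hg := C.nodeDepth_le_depth g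
      have := (ih (by omega)).insert_gate θ e (C.gate g) (fun u => C.val (C.lift g u))
        (fun u => C.nodeDepth (C.lift g u)) (fun x hx => Or.inl (hθ x (C.mem_vars hx)))
        (fun u => Or.inr ⟨C.lift g u, u.2, rfl⟩) (by rw [← nodeDepth_eq]; omega)
      rw [← val_eq, ← nodeDepth_eq] at this
      have hlen := C.inputs_length_le g
      refine this.mono (by rw [Nat.succ_mul]; omega) le_rfl ?_
      rintro p (hp | ⟨g', hg', rfl⟩)
      · exact Or.inr (Or.inl hp)
      · rcases Nat.lt_succ_iff_lt_or_eq.1 hg' with hg' | hg'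
        · exact Or.inr (Or.inr ⟨g', hg', rfl⟩)
        · obtain rfl : g' = g := Fin.ext hg'
          exact Or.inl rfl
  refine (key C.size le_rfl).mono le_rfl le_rfl (Set.union_subset_union_right S ?_)
  rintro _ ⟨g, rfl⟩
  exact ⟨g, g.2, rfl⟩

/-- The polynomial for which an operand stands. -/
def operandPoly (C : Circuit F V) : Operand F V C.size → MvPolynomial V F
  | .const a => MvPolynomial.C a
  | .quantity x => C.quantityPoly x

/-- The operand is not an input variable foreign to the circuit. -/
def IsProper (C : Circuit F V) (u : Operand F V C.size) : Prop :=
  ∀ x, u = .quantity (.input x) → x ∈ C.vars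

theorem operandPoly_operand (C : Circuit F V) (g : Fin C.size) :
    C.operandPoly (C.operand g) = C.val g := by
  rw [operand]
  cases h : C.gate g <;> simp only [operandPoly, quantityPoly]
  · rw [val_eq, h, Gate.eval]
  · rw [val_eq, h, Gate.eval]

theorem isProper_operand (C : Circuit F V) (g : Fin C.size) : C.IsProper (C.operand g) := by
  intro x hx
  rw [operand] at hx
  cases h : C.gate g <;> simp only [h] at hx <;> cases hx
  exact C.mem_vars h

/-- Field axioms are available only for the variables that occur in `C`, so substitutions built from
their placeholders can be controlled only there. -/
theorem aeval_val_congr {R : Type*} [CommRing R] [Algebra F R] (C : Circuit F V) {θ θ' : V → R}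
    (h : ∀ x ∈ C.vars, θ x = θ' x) (g : Fin C.size) :
    aeval θ (C.val g) = aeval θ' (C.val g) := by
  obtain ⟨n, hn⟩ := g
  induction n using Nat.strong_induction_on with
  | _ n ih =>
    replace ih : ∀ u, aeval θ (C.val (C.lift ⟨n, hn⟩ u)) = aeval θ' (C.val (C.lift ⟨n, hn⟩ u)) :=
      fun u => ih u.1 u.2 _
    rw [val_eq]
    cases hg : C.gate ⟨n, hn⟩ with
    | var x => simpa [Gate.eval] using h x (C.mem_vars hg)
    | const a => simp [Gate.eval]
    | add l => simp [Gate.eval, map_list_sum, Function.comp_def, ih]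
    | mul l => simp [Gate.eval, map_list_prod, Function.comp_def, ih]

theorem aeval_operandPoly_congr {R : Type*} [CommRing R] [Algebra F R] (C : Circuit F V)
    {θ θ' : V → R} (h : ∀ x ∈ C.vars, θ x = θ' x) {u : Operand F V C.size} (hu : C.IsProper u) :
    aeval θ (C.operandPoly u) = aeval θ' (C.operandPoly u) := by
  have ih := C.aeval_val_congr h
  rcases u with a | x | g | ⟨g, i⟩
  · simp [operandPoly]
  · simpa [operandPoly, quantityPoly] using h x (hu x rfl)
  · exact ih g
  · rw [operandPoly, quantityPoly]
    split
    · simp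
    · simp
    · simp [map_list_sum, Function.comp_def, ih]
    · simp [map_list_prod, Function.comp_def, ih]

/-- Scalars, variables and gates are cheap or already present. An extension variable is a partial
sum or product of inputs of a gate, and one further unbounded fan-in gate, whose copies cost a
second level, computes it directly. -/
theorem realizes_operand (C : Circuit F V) (h : Realizes N D S) (θ : V → MvPolynomial W F) (e : ℕ)
    (hθ : ∀ x ∈ C.vars, (θ x, e) ∈ S)
    (hS : ∀ g, (aeval θ (C.val g), e + 2 * C.nodeDepth g) ∈ S)
    (hD : e + 2 * C.depth + 2 ≤ D) {u : Operand F V C.size} (hu : C.IsProper u) :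
    Realizes (N + (C.size + 1)) D
      (insert (aeval θ (C.operandPoly u), e + 2 * C.depth + 2) S) := by
  have hdepth (g) : e + 2 * C.nodeDepth g ≤ e + 2 * C.depth := by
    have := C.nodeDepth_le_depth g
    omega
  rcases u with a | x | g | ⟨g, i⟩
  · simpa [operandPoly, algebraMap_eq] using (h.insert_C a _ hD).mono (by omega) le_rfl subset_rfl
  · simpa [operandPoly, quantityPoly] using
      (h.insert_of_le (hθ x (hu x rfl)) (by omega)).mono (by omega) le_rfl subset_rfl
  · exact (h.insert_of_le (hS g) ((hdepth g).trans (by omega))).mono (by omega) le_rfl subset_rfl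
  · have hlen := C.inputs_length_le g
    rw [operandPoly, quantityPoly]
    split
    · simpa [algebraMap_eq] using (h.insert_C 0 _ hD).mono (by omega) le_rfl subset_rfl
    · simpa [algebraMap_eq] using (h.insert_C 0 _ hD).mono (by omega) le_rfl subset_rfl
    · next l hl =>
      rw [hl, Gate.inputs] at hlen
      have := h.insert_sum hD ((l.take (i + 2)).map fun p => (p.1, aeval θ (C.val (C.lift g p.2))))
        (by
          intro p hp
          obtain ⟨q, hq, rfl⟩ := List.mem_map.1 hp
          exact ⟨_, hdepth _, hS _⟩)
      refine (this.mono (N' := N + (C.size + 1)) ?_ le_rfl subset_rfl).mono le_rfl le_rfl ?_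
      · rw [List.length_map, List.length_take]
        omega
      · simp [map_list_sum, Function.comp_def, algebraMap_eq]
    · next l hl =>
      rw [hl, Gate.inputs, List.length_map] at hlen
      have := h.insert_prod hD ((l.take (i + 2)).map fun p => aeval θ (C.val (C.lift g p)))
        (by
          intro p hp
          obtain ⟨q, hq, rfl⟩ := List.mem_map.1 hp
          exact ⟨_, hdepth _, hS _⟩)
      refine (this.mono (N' := N + (C.size + 1)) ?_ le_rfl subset_rfl).mono le_rfl le_rfl ?_
      · rw [List.length_map, List.length_take]
        omega
      · simp [map_list_prod, Function.comp_def]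

end Circuit

/-- A fixed polynomial costs a constant to compute. -/
theorem exists_cost_aeval {σ : Type*} (H : MvPolynomial σ F) :
    ∃ K : ℕ, ∀ (W : Type w) (N D d : ℕ) (S : Set (MvPolynomial W F × ℕ))
      (f : σ → MvPolynomial W F), Realizes N D S → (∀ i, ∃ d' ≤ d, (f i, d') ∈ S) → d + K ≤ D →
        Realizes (N + K) D (insert (aeval f H, d + K) S) := by
  induction H using MvPolynomial.induction_on with
  | C a =>
    refine ⟨1, fun W N D d S f h _ hD => ?_⟩
    simpa [algebraMap_eq] using h.insert_C a (d + 1) hD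
  | add p q hp hq =>
    obtain ⟨K₁, h₁⟩ := hp
    obtain ⟨K₂, h₂⟩ := hq
    -- Two copies and one gate are added. The single constant bounds both the extra nodes and the
    -- extra levels.
    refine ⟨K₁ + K₂ + 3, fun W N D d S f h hf hD => ?_⟩
    have h' := h₂ W _ D d _ f (h₁ W N D d S f h hf (by omega)) (fun i => by
      obtain ⟨d', hd', hi⟩ := hf i
      exact ⟨d', hd', Or.inr hi⟩) (by omega)
    have := h'.insert_sum (d := d + (K₁ + K₂ + 1)) (by omega) [(1, aeval f p), (1, aeval f q)] (by
      simp only [List.forall_mem_cons]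
      exact ⟨⟨_, by omega, Or.inr (Or.inl rfl)⟩, ⟨_, by omega, Or.inl rfl⟩, by simp⟩)
    refine this.mono (by simp; omega) le_rfl ?_
    rintro x (rfl | hx)
    · left
      simp [add_assoc]
    · exact Or.inr (Or.inr (Or.inr hx))
  | mul_X p i hp =>
    obtain ⟨K, hK⟩ := hp
    refine ⟨K + 3, fun W N D d S f h hf hD => ?_⟩
    obtain ⟨d', hd', hi⟩ := hf i
    have := (hK W N D d S f h hf (by omega)).insert_prod (d := d + (K + 1)) (by omega)
      [aeval f p, f i] (by
        simp only [List.forall_mem_cons]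
        exact ⟨⟨_, by omega, Or.inl rfl⟩, ⟨_, by omega, Or.inr hi⟩, by simp⟩)
    refine this.mono (by simp; omega) le_rfl ?_
    rintro x (rfl | hx)
    · left
      simp [add_assoc]
    · exact Or.inr (Or.inr hx)

end Subst

/-! ### Short proofs from the field axioms. -/

section Provable

variable {F : Type u} [Field F] {V : Type v}

/-- There is an `IPS^alg` proof of `p = 0` from the axioms `A` of size at most `N` and depth at
most `D`. -/
def Provable (A : Set (MvPolynomial V F)) (p : MvPolynomial V F) (N D : ℕ) : Prop :=
  ∃ P : Circuit F (V ⊕ A), IsIPSAlgProof A p P ∧ P.size ≤ N ∧ P.depth ≤ D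

theorem Provable.mono {A : Set (MvPolynomial V F)} {p : MvPolynomial V F} {N D N' D' : ℕ}
    (h : Provable A p N D) (hN : N ≤ N') (hD : D ≤ D') : Provable A p N' D' := by
  obtain ⟨P, h₁, h₂, h₃⟩ := h
  exact ⟨P, h₁, h₂.trans hN, h₃.trans hD⟩

theorem ipsAlgDerives_of_provable {A : Set (MvPolynomial V F)} {G : Finset (MvPolynomial V F)}
    {N D s : ℕ} (h : ∀ p ∈ G, Provable A p N D) (hs : G.card * N ≤ s) :
    IPSAlgDerives A G s D := by
  have : ∀ p, ∃ P : Circuit F (V ⊕ A), p ∈ G → IsIPSAlgProof A p P ∧ P.size ≤ N ∧ P.depth ≤ D := by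
    intro p
    by_cases hp : p ∈ G
    · obtain ⟨P, hP⟩ := h p hp
      exact ⟨P, fun _ => hP⟩
    · exact ⟨.single 0, fun h => absurd h hp⟩
  choose P hP using this
  refine ⟨P, fun p hp => ⟨(hP p hp).1, (hP p hp).2.2⟩, le_trans ?_ hs⟩
  rw [← smul_eq_mul]
  exact Finset.sum_le_card_nsmul _ _ _ fun p hp => (hP p hp).2.1

variable [Fintype F]

/-- The `q`th power map is an `F`-algebra endomorphism, hence determined by its values on the
variables. -/
theorem aeval_X_pow_card (p : MvPolynomial V F) :
    aeval (fun x => (X x : MvPolynomial V F) ^ Fintype.card F) p = p ^ Fintype.card F := by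
  have : aeval (fun x => (X x : MvPolynomial V F) ^ Fintype.card F) =
      FiniteField.frobeniusAlgHom F (MvPolynomial V F) := by
    ext x
    simp
  rw [this]
  rfl

/-- The monic polynomial `X ^ q - X` has the `q` elements of `F` as its roots. This links the field
axioms both to the generators in the Nullstellensatz and to the Lagrange polynomials. -/
theorem prod_sub_algebraMap {R : Type*} [CommRing R] [Algebra F R] (z : R) :
    ∏ a : F, (z - algebraMap F R a) = z ^ Fintype.card F - z := by
  have h : ∏ a : F, (Polynomial.X - Polynomial.C a) =
      Polynomial.X ^ Fintype.card F - Polynomial.X := by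
    have hq := Fintype.one_lt_card (α := F)
    have := Polynomial.prod_multiset_X_sub_C_of_monic_of_roots_card_eq
      (p := (Polynomial.X ^ Fintype.card F - Polynomial.X : Polynomial F))
      (Polynomial.monic_X_pow_sub (by simpa using hq)) (by
        rw [FiniteField.roots_X_pow_card_sub_X, FiniteField.X_pow_card_sub_X_natDegree_eq F hq]
        rfl)
    rwa [FiniteField.roots_X_pow_card_sub_X] at this
  simpa [map_prod] using congrArg (Polynomial.aeval z) h

/-- A polynomial combination of the values `z` of some operands, of their values at the points
`x + y`, where the placeholders `y` stand for `x ^ q - x`, and of further placeholders. -/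
theorem exists_provable_aeval {k m : ℕ} (H : MvPolynomial ((Fin k ⊕ Fin k) ⊕ Fin m) F) :
    ∃ K : ℕ, ∀ (V : Type v) (C : Circuit F V) (A : Set (MvPolynomial V F)),
      C.fieldAxioms ⊆ A → ∀ (u : Fin k → Operand F V C.size), (∀ i, C.IsProper (u i)) →
      ∀ (y : Fin m → A) (p : MvPolynomial V F),
        (∀ z : Fin k → MvPolynomial V F,
          aeval (Sum.elim (Sum.elim z z) fun _ => (0 : MvPolynomial V F)) H = 0) →
        aeval (Sum.elim (Sum.elim (fun i => C.operandPoly (u i))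
          fun i => C.operandPoly (u i) ^ Fintype.card F) fun i => (y i : MvPolynomial V F)) H = p →
        Provable A p (K * C.size ^ 2) (K * (C.depth + 1)) := by
  classical
  obtain ⟨K, hK⟩ := exists_cost_aeval.{u, max u v} H
  -- With `s` nodes in `C`, the construction takes `1 + 6 s` nodes for the two substitutions, `2 s
  -- (s + 1)` for two copies of `C`, `2 k (s + 1)` for the operands, `m` for the further
  -- placeholders and `K` for `H`.
  refine ⟨11 + 4 * k + m + K, fun V C A hA u hu y p h₀ h₁ => ?_⟩
  have hmem : ∀ x ∈ C.vars, (X x ^ Fintype.card F - X x : MvPolynomial V F) ∈ A :=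
    fun x hx => hA ⟨x, hx, rfl⟩
  let θ₀ : V → MvPolynomial (V ⊕ A) F := fun x => X (Sum.inl x)
  let θ₁ : V → MvPolynomial (V ⊕ A) F := fun x =>
    if hx : x ∈ C.vars then X (Sum.inl x) + X (Sum.inr ⟨_, hmem x hx⟩) else X (Sum.inl x)
  let D := 2 + 2 * C.depth + 2 + K
  obtain ⟨S₁, hS₁, hθ₀, hθ₁⟩ : ∃ S, Realizes (1 + 6 * C.size) D S ∧
      (∀ x ∈ C.vars, (θ₀ x, 2) ∈ S) ∧ ∀ x ∈ C.vars, (θ₁ x, 2) ∈ S := by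
    have h := ((realizes_empty (F := F) (V := V ⊕ A) D).insert_family C.vars θ₀ 2 1
      fun x _ N' S' _ h => h.insert_X _ _ (by omega)).insert_family C.vars θ₁ 2 5
      fun x hx N' S' _ h => by
        have := ((h.insert_X (Sum.inl x) 0 (by omega)).insert_X
          (Sum.inr ⟨_, hmem x hx⟩) 0 (by omega)).insert_sum (d := 0) (by omega)
          [(1, X (Sum.inl x)), (1, X (Sum.inr ⟨_, hmem x hx⟩))] (by
            simp only [List.forall_mem_cons]
            exact ⟨⟨0, le_rfl, Or.inr (Or.inl rfl)⟩, ⟨0, le_rfl, Or.inl rfl⟩, by simp⟩)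
        refine this.mono le_rfl le_rfl ?_
        rintro q (rfl | hq)
        · left
          simp [θ₁, hx]
        · exact Or.inr (Or.inr (Or.inr hq))
    have hcard := C.card_vars_le
    exact ⟨_, h.mono (by omega) le_rfl subset_rfl, fun x hx => Or.inl (Or.inr ⟨x, hx, rfl⟩),
      fun x hx => Or.inr ⟨x, hx, rfl⟩⟩
  have hS₂ := C.realizes_subst (C.realizes_subst hS₁ θ₀ 2 hθ₀ (by omega)) θ₁ 2
    (fun x hx => Or.inl (hθ₁ x hx)) (by omega)
  have hS₃ := ((hS₂.insert_family (Finset.univ : Finset (Fin k))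
    (fun i => aeval θ₀ (C.operandPoly (u i))) (2 + 2 * C.depth + 2) (C.size + 1)
    fun i _ N' S' hS h => C.realizes_operand h θ₀ 2
      (fun x hx => hS (Or.inl (Or.inl (hθ₀ x hx)))) (fun g => hS (Or.inl (Or.inr ⟨g, rfl⟩)))
      (by omega) (hu i)).insert_family (Finset.univ : Finset (Fin k))
    (fun i => aeval θ₁ (C.operandPoly (u i))) (2 + 2 * C.depth + 2) (C.size + 1)
    fun i _ N' S' hS h => C.realizes_operand h θ₁ 2
      (fun x hx => hS (Or.inl (Or.inl (Or.inl (hθ₁ x hx)))))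
      (fun g => hS (Or.inl (Or.inr ⟨g, rfl⟩))) (by omega) (hu i)).insert_family
    (Finset.univ : Finset (Fin m)) (fun i => X (Sum.inr (y i))) 0 1
    fun i _ N' S' hS h => h.insert_X _ _ (by omega)
  have hS₄ := hK (V ⊕ A) _ D (2 + 2 * C.depth + 2) _
    (Sum.elim (Sum.elim (fun i => aeval θ₀ (C.operandPoly (u i)))
      fun i => aeval θ₁ (C.operandPoly (u i))) fun i => X (Sum.inr (y i))) hS₃ (by
      rintro ((i | i) | i)
      · exact ⟨_, le_rfl, Or.inl (Or.inl (Or.inr ⟨i, Finset.mem_univ i, rfl⟩))⟩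
      · exact ⟨_, le_rfl, Or.inl (Or.inr ⟨i, Finset.mem_univ i, rfl⟩)⟩
      · exact ⟨0, Nat.zero_le _, Or.inr ⟨i, Finset.mem_univ i, rfl⟩⟩) le_rfl
  obtain ⟨P, hP, hsize, hdepth⟩ := hS₄.exists_circuit (Set.mem_insert _ _)
  refine ⟨P, ⟨?_, ?_⟩, hsize.trans ?_, hdepth.trans ?_⟩
  -- With all placeholders `0`, the shifted and the unshifted operands agree.
  · rw [hP, comp_aeval_apply]
    refine Eq.trans ?_ (h₀ fun i => C.operandPoly (u i))
    congr 2
    funext i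
    rcases i with (i | i) | i
    · simp only [Sum.elim_inl, comp_aeval_apply, θ₀, aeval_X]
      exact aeval_X_left_apply _
    · simp only [Sum.elim_inl, Sum.elim_inr, comp_aeval_apply]
      rw [C.aeval_operandPoly_congr (θ' := X) _ (hu i), aeval_X_left_apply]
      intro x hx
      simp [θ₁, hx]
    · simp
  -- With the axioms inserted, the shift becomes `x ↦ x ^ q`, so the shifted operands are `q`th
  -- powers.
  · rw [hP, comp_aeval_apply, ← h₁]
    congr 2
    funext i
    rcases i with (i | i) | i
    · simp only [Sum.elim_inl, comp_aeval_apply, θ₀, aeval_X]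
      exact aeval_X_left_apply _
    · simp only [Sum.elim_inl, Sum.elim_inr, comp_aeval_apply]
      rw [← aeval_X_pow_card]
      refine C.aeval_operandPoly_congr (fun x hx => ?_) (hu i)
      simp [θ₁, hx]
    · simp
  · have hs := C.size_pos
    simp only [Finset.card_univ, Fintype.card_fin]
    generalize C.size = s at hs
    have h₁ : s ≤ s ^ 2 := Nat.le_self_pow two_ne_zero s
    have h₂ : 1 ≤ s ^ 2 := hs.trans_le h₁
    have h₃ := Nat.mul_le_mul_left k h₁
    have h₄ := Nat.mul_le_mul_left k h₂
    have h₅ := Nat.mul_le_mul_left m h₂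
    have h₆ := Nat.mul_le_mul_left K h₂
    linarith
  · have : K * 1 ≤ K * (C.depth + 1) := Nat.mul_le_mul_left K (by omega)
    have h₂ := Nat.zero_le ((4 * k + m) * (C.depth + 1))
    simp only [D]
    linarith

/-- A polynomial that vanishes on all points over `F` is provably zero on all operands. -/
theorem exists_provable_of_eval_eq_zero {k : ℕ} (G : MvPolynomial (Fin k) F)
    (hG : ∀ t, eval t G = 0) :
    ∃ K : ℕ, ∀ (V : Type v) (C : Circuit F V) (A : Set (MvPolynomial V F)),
      C.fieldAxioms ⊆ A → ∀ (u : Fin k → Operand F V C.size), (∀ i, C.IsProper (u i)) →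
        Provable A (aeval (fun i => C.operandPoly (u i)) G) (K * C.size ^ 2)
          (K * (C.depth + 1)) := by
  -- On the full grid `F ^ k` the generators `∏ a, (X_i - a)` are `X_i ^ q - X_i`. The coefficients
  -- `h i` depend on `G` alone, so computing them costs a constant.
  obtain ⟨h, -, rfl⟩ := combinatorial_nullstellensatz_exists_linearCombination
    (fun _ => Finset.univ) (fun _ => Finset.univ_nonempty) G fun t _ => hG t
  obtain ⟨K, hK⟩ := exists_provable_aeval.{u, v} (k := k) (m := 0)
    (∑ i, rename (fun i => Sum.inl (Sum.inl i)) (h i) *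
      (X (Sum.inl (Sum.inr i)) - X (Sum.inl (Sum.inl i))) :
      MvPolynomial ((Fin k ⊕ Fin k) ⊕ Fin 0) F)
  refine ⟨K, fun V C A hA u hu => hK V C A hA u hu Fin.elim0 _ (fun z => ?_) ?_⟩
  · simp
  · rw [Finsupp.linearCombination_apply, Finsupp.sum_fintype _ _ (by simp)]
    simp only [map_sum, map_mul, map_sub, aeval_X, Sum.elim_inl, Sum.elim_inr, aeval_rename,
      smul_eq_mul, map_prod, aeval_C, prod_sub_algebraMap]
    rfl

/-- A polynomial that vanishes at `0` is provably zero on any axiom. -/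
theorem exists_provable_of_eval_zero (G : MvPolynomial (Fin 1) F) (hG : eval 0 G = 0) :
    ∃ K : ℕ, ∀ (V : Type v) (C : Circuit F V) (A : Set (MvPolynomial V F)),
      C.fieldAxioms ⊆ A → ∀ p ∈ A, Provable A (aeval (fun _ => p) G) (K * C.size ^ 2)
        (K * (C.depth + 1)) := by
  obtain ⟨K, hK⟩ := exists_provable_aeval.{u, v} (k := 0) (m := 1)
    (rename Sum.inr G : MvPolynomial ((Fin 0 ⊕ Fin 0) ⊕ Fin 1) F)
  refine ⟨K, fun V C A hA p hp => hK V C A hA Fin.elim0 (fun i => i.elim0) (fun _ => ⟨p, hp⟩) _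
    (fun z => ?_) ?_⟩
  · rw [aeval_rename]
    rw [eval_zero] at hG
    exact (aeval_zero G).trans (by rw [hG, map_zero])
  · rw [aeval_rename]
    rfl

end Provable

/-! ### Clauses and Lagrange polynomials at points over the field. -/

section ClausePoly

variable {F : Type u} [Field F] {V : Type v} {W : Type w}

theorem map_clausePoly {α : Type*} (φ : MvPolynomial V F →ₐ[F] MvPolynomial W F)
    (b : α → MvPolynomial V F) (c : Finset (α × Bool)) :
    φ (CNF.clausePoly b c) = CNF.clausePoly (fun x => φ (b x)) c := by
  simp only [CNF.clausePoly, map_prod, apply_ite φ, map_sub, map_one]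

/-- A true literal contributes a zero factor. -/
theorem eval_clausePoly_eq_zero {α : Type*} (t : V → F) (b : α → MvPolynomial V F)
    (ρ : α → Bool) (hρ : ∀ x, eval t (b x) = if ρ x then 1 else 0) (c : Finset (α × Bool))
    (h : ∃ l ∈ c, ρ l.1 = l.2) : eval t (CNF.clausePoly b c) = 0 := by
  obtain ⟨l, hl, h⟩ := h
  rw [CNF.clausePoly, map_prod]
  refine Finset.prod_eq_zero hl ?_
  cases h' : l.2 <;> simp [hρ, h, h']

end ClausePoly

section Ubit

variable {F : Type u} [Field F] [Fintype F] {V : Type v} {W : Type w}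

theorem map_ubit (φ : MvPolynomial V F →ₐ[F] MvPolynomial W F) (j : F) (p : MvPolynomial V F) :
    φ (Circuit.ubit j p) = Circuit.ubit j (φ p) := by
  simp only [Circuit.ubit, map_mul, map_prod, map_sub, algHom_C, algebraMap_eq]

open Classical in
theorem ubit_C (j a : F) :
    Circuit.ubit j (C a : MvPolynomial V F) = if a = j then 1 else 0 := by
  simp only [Circuit.ubit, ← map_sub, ← map_prod, ← map_mul]
  split_ifs with h
  · subst h
    rw [inv_mul_cancel₀, map_one]
    exact Finset.prod_ne_zero_iff.2 fun i hi => sub_ne_zero.2 (Finset.ne_of_mem_erase hi).symm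
  · rw [Finset.prod_eq_zero (i := a) (Finset.mem_erase.2 ⟨h, Finset.mem_univ a⟩) (sub_self a),
      mul_zero, map_zero]

open Classical in
theorem eval_ubit (t : V → F) (j : F) (p : MvPolynomial V F) :
    eval t (Circuit.ubit j p) = if eval t p = j then 1 else 0 := by
  -- Evaluation at `t` is a substitution of constants, which reduces the claim to `ubit_C`.
  have h : ∀ r, (aeval fun x => (C (t x) : MvPolynomial V F)) r = C (eval t r) := by
    intro r
    simpa [algebraMap_eq, aeval_eq_eval, Function.comp_def] using
      aeval_algebraMap_apply (MvPolynomial V F) t r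
  apply C_injective V F
  rw [← h, map_ubit, h, ubit_C]
  split_ifs <;> simp

namespace Circuit

/-- Substitution of the Lagrange polynomials for the unary bits. -/
def bitSubst (C : Circuit F V) : MvPolynomial (Quantity V C.size × F) F →ₐ[F] MvPolynomial V F :=
  aeval fun y => ubit y.2 (C.quantityPoly y.1)

theorem bitSubst_bit (C : Circuit F V) (x : Operand F V C.size) (j : F) :
    C.bitSubst (x.bit j) = ubit j (C.operandPoly x) := by
  cases x with
  | const a =>
    rw [operandPoly, ubit_C, Operand.bit]
    split_ifs <;> simp
  | quantity y => simp [Operand.bit, operandPoly, bitSubst]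

end Circuit

/-! ### Short proofs of the equations of the semi-CNF, and of the converse. -/

/-- A common bound for finitely many polynomials that vanish over `F`. -/
theorem exists_provable_of_finite {k : ℕ} {ι : Type*} [Finite ι] (G : ι → MvPolynomial (Fin k) F) :
    ∃ K : ℕ, ∀ i, (∀ t, eval t (G i) = 0) → ∀ (V : Type v) (C : Circuit F V)
      (A : Set (MvPolynomial V F)), C.fieldAxioms ⊆ A → ∀ (u : Fin k → Operand F V C.size),
      (∀ i, C.IsProper (u i)) → Provable A (aeval (fun j => C.operandPoly (u j)) (G i))
        (K * C.size ^ 2) (K * (C.depth + 1)) := by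
  have : ∀ i, ∃ K : ℕ, (∀ t, eval t (G i) = 0) → ∀ (V : Type v) (C : Circuit F V)
      (A : Set (MvPolynomial V F)), C.fieldAxioms ⊆ A → ∀ (u : Fin k → Operand F V C.size),
      (∀ i, C.IsProper (u i)) → Provable A (aeval (fun j => C.operandPoly (u j)) (G i))
        (K * C.size ^ 2) (K * (C.depth + 1)) := by
    intro i
    by_cases h : ∀ t, eval t (G i) = 0
    · obtain ⟨K, hK⟩ := exists_provable_of_eval_eq_zero.{u, v} (G i) h
      exact ⟨K, fun _ => hK⟩
    · exact ⟨0, fun h' => absurd h' h⟩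
  choose K hK using this
  obtain ⟨M, hM⟩ := Finite.exists_le K
  exact ⟨M, fun i hi V C A hA u hu => (hK i hi V C A hA u hu).mono
    (Nat.mul_le_mul_right _ (hM i)) (Nat.mul_le_mul_right _ (hM i))⟩

/-- The translated clauses of the uniqueness CNFs of the variables. -/
theorem exists_provable_exactlyOne :
    ∃ K : ℕ, ∀ (V : Type v) (C : Circuit F V) (A : Set (MvPolynomial V F)), C.fieldAxioms ⊆ A →
      ∀ x ∈ C.vars, ∀ c ∈ CNF.exactlyOne F,
        Provable A (C.bitSubst (CNF.clausePoly (fun j => X (.input x, j)) c))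
          (K * C.size ^ 2) (K * (C.depth + 1)) := by
  classical
  obtain ⟨K, hK⟩ := exists_provable_of_finite.{u, v} (F := F) (k := 1)
    (fun c : Finset (F × Bool) => CNF.clausePoly (fun j => Circuit.ubit j (X 0)) c)
  refine ⟨K, fun V C A hA x hx c hc => ?_⟩
  have := hK c (fun t => ?_) V C A hA (fun _ => .quantity (.input x)) (by
    rintro - y hy
    cases hy
    exact hx)
  · rw [map_clausePoly] at this ⊢
    simpa [map_ubit, Circuit.operandPoly, Circuit.bitSubst] using this
  -- The bits of an actual field element satisfy the uniqueness clauses.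
  · refine eval_clausePoly_eq_zero t _ (fun j => decide (t 0 = j)) (fun j => ?_) c ?_
    · simp [eval_ubit]
    · rw [CNF.exactlyOne, Finset.mem_insert] at hc
      rcases hc with rfl | hc
      · exact ⟨(t 0, true), Finset.mem_image_of_mem _ (Finset.mem_univ _), by simp⟩
      · obtain ⟨⟨i, j⟩, hij, rfl⟩ := Finset.mem_image.1 hc
        have hij : i ≠ j := by simpa using hij
        by_cases h : t 0 = i
        · exact ⟨(j, false), by simp, by simp [h, hij]⟩
        · exact ⟨(i, false), by simp, by simp [h]⟩

/-- The translated Boolean axioms. -/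
theorem exists_provable_boolean :
    ∃ K : ℕ, ∀ (V : Type v) (C : Circuit F V) (A : Set (MvPolynomial V F)), C.fieldAxioms ⊆ A →
      ∀ x, C.IsProper (.quantity x) → ∀ j,
        Provable A (C.bitSubst (X (x, j) ^ 2 - X (x, j)))
          (K * C.size ^ 2) (K * (C.depth + 1)) := by
  classical
  obtain ⟨K, hK⟩ := exists_provable_of_finite.{u, v} (F := F) (k := 1)
    (fun j : F => Circuit.ubit j (X 0) ^ 2 - Circuit.ubit j (X 0))
  refine ⟨K, fun V C A hA x hx j => ?_⟩
  have := hK j (fun t => by simp [eval_ubit]) V C A hA (fun _ => .quantity x) fun _ => hx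
  simpa [map_ubit, Circuit.operandPoly, Circuit.bitSubst] using this

/-- The translated clauses of a truth table, for operations that belong to finitely many
polynomials. -/
theorem exists_provable_step {k : ℕ} {ι : Type u} [Finite ι] (R : ι → MvPolynomial (Fin k) F) :
    ∃ K : ℕ, ∀ i, ∀ (V : Type v) (C : Circuit F V) (A : Set (MvPolynomial V F)),
      C.fieldAxioms ⊆ A → ∀ (op : (Fin k → F) → F), (∀ t, eval t (R i) = op t) →
      ∀ φ, CNF.IsTruthTable op φ → ∀ c ∈ φ, ∀ (arg : Fin k → Operand F V C.size)
        (res : Operand F V C.size), (∀ j, C.IsProper (arg j)) →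
        C.operandPoly res = aeval (fun j => C.operandPoly (arg j)) (R i) →
        Provable A (C.bitSubst (CNF.clausePoly (fun y => (y.1.elim res arg).bit y.2) c))
          (K * C.size ^ 2) (K * (C.depth + 1)) := by
  classical
  -- The index runs over all clauses in the bits of `k` arguments and a result, so the bound is
  -- independent of the CNF. The result is replaced by `R p.1`, which leaves a polynomial in the
  -- arguments only.
  obtain ⟨K, hK⟩ := exists_provable_of_finite.{u, v} (F := F) (k := k)
    (fun p : ι × Finset ((Option (Fin k) × F) × Bool) =>
      CNF.clausePoly (fun y => Circuit.ubit y.2 (y.1.elim (R p.1) X)) p.2)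
  refine ⟨K, fun i V C A hA op hop φ hφ c hc arg res harg hres => ?_⟩
  have := hK (i, c) (fun t => ?_) V C A hA arg harg
  · rw [map_clausePoly] at this ⊢
    convert this using 3 with y
    obtain ⟨y, j⟩ := y
    rw [C.bitSubst_bit, map_ubit]
    cases y <;> simp [hres]
  -- These are the bits of the point `t` and of the value of the operation there, so the truth table
  -- holds.
  · let ρ : Option (Fin k) × F → Bool := fun y => decide (eval t (y.1.elim (R i) X) = y.2)
    refine eval_clausePoly_eq_zero t _ ρ (fun y => ?_) c ?_
    · simp [eval_ubit, ρ]
    · exact ((hφ.1 t ρ fun i j => by simp [ρ]).2 fun j => by simp [ρ, hop]) c hc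

/-- The translated bits of the output node. -/
theorem exists_provable_output :
    ∃ K : ℕ, ∀ (V : Type v) (C : Circuit F V) (A : Set (MvPolynomial V F)), C.fieldAxioms ⊆ A →
      C.poly ∈ A →
        Provable A (C.bitSubst ((C.operand C.out).bit 0 - 1))
          (K * C.size ^ 2) (K * (C.depth + 1)) ∧
        ∀ j ≠ 0, Provable A (C.bitSubst ((C.operand C.out).bit j))
          (K * C.size ^ 2) (K * (C.depth + 1)) := by
  classical
  -- The subtracted constant is the value of the Lagrange polynomial at `0`.
  have : ∀ j : F, ∃ K : ℕ, ∀ (V : Type v) (C : Circuit F V) (A : Set (MvPolynomial V F)),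
      C.fieldAxioms ⊆ A → ∀ p ∈ A, Provable A
        (aeval (fun _ => p) (Circuit.ubit j (X 0) - if 0 = j then 1 else 0 : MvPolynomial (Fin 1) F))
        (K * C.size ^ 2) (K * (C.depth + 1)) := fun j =>
    exists_provable_of_eval_zero.{u, v} _ (by
      rw [map_sub, eval_ubit]
      simp)
  choose K hK using this
  obtain ⟨M, hM⟩ := Finite.exists_le K
  refine ⟨M, fun V C A hA hC => ⟨?_, fun j hj => ?_⟩⟩
  · have := hK 0 V C A hA _ hC
    rw [map_sub, map_ubit, if_pos rfl, aeval_X, map_one] at this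
    rw [map_sub, C.bitSubst_bit, C.operandPoly_operand, map_one]
    exact this.mono (Nat.mul_le_mul_right _ (hM 0)) (Nat.mul_le_mul_right _ (hM 0))
  · have := hK j V C A hA _ hC
    rw [map_sub, map_ubit, if_neg hj.symm, aeval_X, map_zero, sub_zero] at this
    rw [C.bitSubst_bit, C.operandPoly_operand]
    exact this.mono (Nat.mul_le_mul_right _ (hM j)) (Nat.mul_le_mul_right _ (hM j))

/-- A circuit equation follows from the bit `0` of its output. -/
theorem exists_provable_poly :
    ∃ K : ℕ, ∀ (V : Type v) (C : Circuit F V) (A : Set (MvPolynomial V F)), C.fieldAxioms ⊆ A →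
      Circuit.ubit 0 C.poly - 1 ∈ A →
        Provable A C.poly (K * C.size ^ 2) (K * (C.depth + 1)) := by
  classical
  let c : F := (∏ i ∈ Finset.univ.erase 0, (0 - i))⁻¹
  obtain ⟨K, hK⟩ := exists_provable_aeval.{u, v} (k := 1) (m := 1)
    (- (X (Sum.inl (Sum.inl 0)) * X (Sum.inr 0)) +
      C c * (X (Sum.inl (Sum.inr 0)) - X (Sum.inl (Sum.inl 0))) :
      MvPolynomial ((Fin 1 ⊕ Fin 1) ⊕ Fin 1) F)
  refine ⟨K, fun V C A hA hC => hK V C A hA (fun _ => C.operand C.out)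
    (fun _ => C.isProper_operand _) (fun _ => ⟨_, hC⟩) _ (fun z => ?_) ?_⟩
  · simp
  · have h : C.poly ^ Fintype.card F - C.poly =
        C.poly * ∏ i ∈ Finset.univ.erase 0, (C.poly - MvPolynomial.C i) := by
      rw [← prod_sub_algebraMap, ← Finset.mul_prod_erase _ _ (Finset.mem_univ (0 : F)),
        algebraMap_eq, map_zero, sub_zero]
    simp only [map_add, map_neg, map_mul, map_sub, aeval_X, Sum.elim_inl, Sum.elim_inr,
      C.operandPoly_operand, aeval_C]
    change -(C.poly * _) + _ * (C.poly ^ _ - C.poly) = C.poly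
    rw [h, Circuit.ubit, algebraMap_eq]
    ring

end Ubit

/-! ### The shape of the equations of a gate. -/

namespace Circuit

variable {F : Type u} [Field F] {V : Type v}

/-- The step is the equation `res = a u` for some operands. -/
def IsUnaryStep (C : Circuit F V) (s : Step F V C.size) : Prop :=
  ∃ (a : F) (u res : Operand F V C.size), s = ⟨fun x : Fin 1 → F => a * x 0, ![u], res⟩ ∧
    C.IsProper u ∧ C.operandPoly res = MvPolynomial.C a * C.operandPoly u

/-- The step is the equation `res = a u ∘ b v` for some operands, where `op'` is the operation `∘`
on polynomials. -/
def IsBinaryStep (C : Circuit F V) (op : F → F → F)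
    (op' : MvPolynomial V F → MvPolynomial V F → MvPolynomial V F) (s : Step F V C.size) : Prop :=
  ∃ (a b : F) (u v res : Operand F V C.size),
    s = ⟨fun x : Fin 2 → F => op (a * x 0) (b * x 1), ![u, v], res⟩ ∧
    C.IsProper u ∧ C.IsProper v ∧
    C.operandPoly res = op' (MvPolynomial.C a * C.operandPoly u) (MvPolynomial.C b * C.operandPoly v)

section Steps

variable (C : Circuit F V) (op : F → F → F)
  (op' : MvPolynomial V F → MvPolynomial V F → MvPolynomial V F) (g : Fin C.size)
  (L : List (F × Operand F V C.size)) (fold : List (F × Operand F V C.size) → MvPolynomial V F)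

/-- Here `fold` stands for the sum or the product of a list of labelled operands, so both kinds of
gates are treated at once. The invariant is that `pre` holds the inputs consumed so far and `ext g
i` is their fold; the offset `2` appears because `ext g 0` already combines two inputs. -/
theorem isBinaryStep_of_mem_stepsFrom
    (happend : ∀ l x, fold (l ++ [x]) = op' (MvPolynomial.C x.1 * C.operandPoly x.2) (fold l))
    (hext : ∀ i, C.quantityPoly (.ext g i) = fold (L.take (i + 2)))
    (hgate : C.val g = fold L) (hL : ∀ x ∈ L, C.IsProper x.2)
    (l : List (F × Operand F V C.size)) : ∀ (i : ℕ) (x : F × Operand F V C.size)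
    (pre : List (F × Operand F V C.size)), pre.length = i + 2 → L = pre ++ x :: l →
    ∀ s ∈ stepsFrom op g i x l, C.IsBinaryStep op op' s := by
  have step : ∀ (i : ℕ) (x : F × Operand F V C.size) (pre post : List (F × Operand F V C.size))
      (res : Operand F V C.size), pre.length = i + 2 → L = pre ++ x :: post →
      C.operandPoly res = fold (pre ++ [x]) →
      C.IsBinaryStep op op'
        ⟨fun y : Fin 2 → F => op (x.1 * y 0) (y 1), ![x.2, .quantity (.ext g i)], res⟩ := by
    intro i x pre post res hpre hLpre hres
    -- The partial result enters with label `1`, which makes the step an instance of the general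
    -- binary form.
    refine ⟨x.1, 1, x.2, .quantity (.ext g i), res, by simp only [one_mul],
      hL x (by simp [hLpre]), fun y hy => (by cases hy), ?_⟩
    rw [hres, happend, map_one, one_mul]
    change _ = op' _ (C.quantityPoly (.ext g i))
    rw [hext, hLpre, List.take_left' hpre]
  induction l with
  | nil =>
    rintro i ⟨a, u⟩ pre hpre hLpre s hs
    rw [stepsFrom, List.mem_singleton] at hs
    subst hs
    exact step i (a, u) pre [] _ hpre hLpre (by rw [← hLpre]; exact hgate)
  | cons b l ih =>
    rintro i ⟨a, u⟩ pre hpre hLpre s hs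
    have hLpre' : L = (pre ++ [(a, u)]) ++ b :: l := by simpa using hLpre
    have hlen : (pre ++ [(a, u)]).length = i + 1 + 2 := by simp [hpre]
    rw [stepsFrom, List.mem_cons] at hs
    rcases hs with rfl | hs
    · refine step i (a, u) pre (b :: l) _ hpre hLpre ?_
      rw [operandPoly, hext, hLpre', List.take_left' hlen]
    · exact ih (i + 1) b _ hlen hLpre' s hs

/-- Commutativity enters because the chain puts each new input to the left of the partial result,
whereas the first equation reads `u₁ ∘ u₂`. -/
theorem isStep_of_mem_stepsOf
    (happend : ∀ l x, fold (l ++ [x]) = op' (MvPolynomial.C x.1 * C.operandPoly x.2) (fold l))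
    (hone : ∀ x, fold [x] = MvPolynomial.C x.1 * C.operandPoly x.2)
    (hcomm : ∀ p q, op' p q = op' q p)
    (hext : ∀ i, C.quantityPoly (.ext g i) = fold (L.take (i + 2)))
    (hgate : C.val g = fold L) (hL : ∀ x ∈ L, C.IsProper x.2) :
    ∀ s ∈ stepsOf op g L, C.IsUnaryStep s ∨ C.IsBinaryStep op op' s := by
  have htwo : ∀ x y, fold [x, y] =
      op' (MvPolynomial.C x.1 * C.operandPoly x.2) (MvPolynomial.C y.1 * C.operandPoly y.2) := by
    intro x y
    rw [← List.singleton_append, happend, hone, hcomm]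
  intro s hs
  match L, hs with
  | [(a, u)], hs =>
    rw [stepsOf, List.mem_singleton] at hs
    subst hs
    exact Or.inl ⟨a, u, _, rfl, hL (a, u) (by simp), hgate.trans (hone (a, u))⟩
  | [(a, u), (b, v)], hs =>
    rw [stepsOf, List.mem_singleton] at hs
    subst hs
    exact Or.inr ⟨a, b, u, v, _, rfl, hL (a, u) (by simp), hL (b, v) (by simp),
      hgate.trans (htwo (a, u) (b, v))⟩
  | (a, u) :: (b, v) :: c :: l, hs =>
    rw [stepsOf, List.mem_cons] at hs
    right
    rcases hs with rfl | hs
    · exact ⟨a, b, u, v, _, rfl, hL (a, u) (by simp), hL (b, v) (by simp),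
        (hext 0).trans (htwo (a, u) (b, v))⟩
    · exact C.isBinaryStep_of_mem_stepsFrom op op' g ((a, u) :: (b, v) :: c :: l) fold happend hext
        hgate hL l 0 c [(a, u), (b, v)] rfl rfl s hs

end Steps

/-- All equations of a circuit are unary steps, binary sums or binary products. -/
theorem isStep_of_mem_steps (C : Circuit F V) (g : Fin C.size) (s : Step F V C.size)
    (hs : s ∈ C.steps g) :
    C.IsUnaryStep s ∨ C.IsBinaryStep (fun x y => x + y) (fun p q => p + q) s ∨
      C.IsBinaryStep (fun x y => x * y) (fun p q => p * q) s := by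
  have hL : ∀ l : List (F × Fin g), ∀ x ∈ l.map (fun p => (p.1, C.operand (C.lift g p.2))),
      C.IsProper x.2 := by
    rintro l x hx
    obtain ⟨p, -, rfl⟩ := List.mem_map.1 hx
    exact C.isProper_operand _
  rw [steps] at hs
  cases hg : C.gate g with
  | var x => simp [hg, Gate.inputs, stepsOf] at hs
  | const a => simp [hg, Gate.inputs, stepsOf] at hs
  | add l =>
    rw [hg] at hs
    refine (C.isStep_of_mem_stepsOf (fun x y => x + y) (fun p q => p + q) g _
      (fun l => (l.map fun x => MvPolynomial.C x.1 * C.operandPoly x.2).sum)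
      (fun l x => by simp [add_comm]) (fun x => by simp) add_comm (fun i => ?_) ?_ (hL l)
      s hs).imp_right Or.inl
    · simp only [quantityPoly, hg, ← List.map_take, List.map_map, Function.comp_def,
        operandPoly_operand]
    · simp only [val_eq C g, hg, Gate.eval, List.map_map, Function.comp_def, operandPoly_operand]
  | mul l =>
    rw [hg] at hs
    refine (C.isStep_of_mem_stepsOf (fun x y => x * y) (fun p q => p * q) g _
      (fun l => (l.map fun x => MvPolynomial.C x.1 * C.operandPoly x.2).prod)
      (fun l x => by simp [mul_comm]) (fun x => by simp) mul_comm (fun i => ?_) ?_ (hL _)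
      s hs).imp_right Or.inr
    · simp only [quantityPoly, hg, ← List.map_take, List.map_map, Function.comp_def,
        operandPoly_operand, Gate.inputs, map_one, one_mul]
    · simp only [val_eq C g, hg, Gate.eval, List.map_map, Function.comp_def, operandPoly_operand,
        Gate.inputs, map_one, one_mul]

/-! ### Counting the equations, and assembling the derivations. -/

theorem length_stepsFrom {n : ℕ} (op : F → F → F) (g : Fin n) (l : List (F × Operand F V n)) :
    ∀ i x, (stepsFrom op g i x l).length = l.length + 1 := by
  induction l with
  | nil => exact fun i x => rfl
  | cons b l ih => exact fun i x => by simp [stepsFrom, ih]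

theorem length_steps_le (C : Circuit F V) (g : Fin C.size) : (C.steps g).length ≤ C.size := by
  have h : ∀ (op : F → F → F) (L : List (F × Operand F V C.size)),
      (stepsOf op g L).length ≤ L.length := by
    intro op L
    match L with
    | [] => exact le_rfl
    | [_] => exact le_rfl
    | [_, _] => simp [stepsOf]
    | _ :: _ :: _ :: _ => simp [stepsOf, length_stepsFrom]
  refine (h _ _).trans ?_
  rw [List.length_map]
  exact C.inputs_length_le g

theorem card_quantities_le (C : Circuit F V) : C.quantities.card ≤ 3 * C.size ^ 2 := by
  classical
  have h₁ : (C.vars.image (Quantity.input (n := C.size))).card ≤ C.size :=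
    Finset.card_image_le.trans C.card_vars_le
  have h₂ : ((Finset.univ.filter fun g => (C.gate g).IsOp).image
      (Quantity.gate (V := V))).card ≤ C.size :=
    Finset.card_image_le.trans ((Finset.card_filter_le _ _).trans (by simp))
  have h₃ : (Finset.univ.biUnion fun g =>
      (Finset.range ((C.gate g).inputs.length - 2)).image (Quantity.ext (V := V) g)).card ≤
      C.size * C.size := by
    refine (Finset.card_biUnion_le_card_mul _ _ C.size fun g _ => ?_).trans (by simp)
    refine Finset.card_image_le.trans ?_
    rw [Finset.card_range]
    exact (Nat.sub_le _ _).trans (C.inputs_length_le g)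
  have h₄ : C.size ≤ C.size ^ 2 := Nat.le_self_pow two_ne_zero _
  rw [quantities]
  refine (Finset.card_union_le _ _).trans ?_
  have := Finset.card_union_le (C.vars.image (Quantity.input (n := C.size)))
    ((Finset.univ.filter fun g => (C.gate g).IsOp).image (Quantity.gate (V := V)))
  rw [← sq] at h₃
  omega

theorem isProper_of_mem_quantities (C : Circuit F V) {x : Quantity V C.size}
    (hx : x ∈ C.quantities) : C.IsProper (.quantity x) := by
  classical
  rintro y hy
  cases hy
  simpa [quantities] using hx

/-- A derivation pays for one proof per equation. There are at most quadratically many steps and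
quantities, and a chosen CNF has no more clauses than exist in the bits of at most two arguments and
a result. -/
theorem exists_card_scnf_le (F : Type u) [Field F] [Fintype F] :
    ∃ M : ℕ, ∀ (V : Type v) (C : Circuit F V) (T : TruthTables F),
      (C.scnf T).card ≤ M * C.size ^ 2 := by
  classical
  let M₁ := Fintype.card (Finset ((Option (Fin 1) × F) × Bool))
  let M₂ := Fintype.card (Finset ((Option (Fin 2) × F) × Bool))
  refine ⟨(CNF.exactlyOne F).card + (M₁ + M₂) + 3 * Fintype.card F + (Fintype.card F + 1),
    fun V C T => ?_⟩
  have hs : 1 ≤ C.size := C.size_pos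
  have hs' : C.size ≤ C.size ^ 2 := Nat.le_self_pow two_ne_zero _
  have h₁ : (C.vars.biUnion fun x => (CNF.exactlyOne F).image (CNF.clausePoly fun j =>
      (X (Quantity.input x, j) : MvPolynomial (Quantity V C.size × F) F))).card ≤
      (CNF.exactlyOne F).card * C.size ^ 2 := by
    rw [mul_comm]
    exact (Finset.card_biUnion_le_card_mul _ _ _ fun x _ => Finset.card_image_le).trans
      (Nat.mul_le_mul_right _ (C.card_vars_le.trans hs'))
  have h₂ : (Finset.univ.biUnion fun g => (C.steps g).toFinset.biUnion fun s =>
      (T.cnf s.op).image (CNF.clausePoly fun y => (match y.1 with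
          | some i => s.arg i
          | none => s.res).bit y.2)).card ≤ (M₁ + M₂) * C.size ^ 2 := by
    refine (Finset.card_biUnion_le_card_mul _ _ (C.size * (M₁ + M₂)) fun g _ => ?_).trans
      (le_of_eq ?_)
    · refine (Finset.card_biUnion_le_card_mul _ _ (M₁ + M₂) fun s hs => ?_).trans
        (Nat.mul_le_mul_right _ ((List.toFinset_card_le _).trans (C.length_steps_le g)))
      refine Finset.card_image_le.trans ?_
      rcases C.isStep_of_mem_steps g s (List.mem_toFinset.1 hs) with
        ⟨a, u, res, rfl, -⟩ | ⟨a, b, u, v, res, rfl, -⟩ | ⟨a, b, u, v, res, rfl, -⟩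
      · exact (Finset.card_le_univ _).trans (Nat.le_add_right _ _)
      · exact (Finset.card_le_univ _).trans (Nat.le_add_left _ _)
      · exact (Finset.card_le_univ _).trans (Nat.le_add_left _ _)
    · rw [Finset.card_univ, Fintype.card_fin]
      ring
  have h₃ : ((C.quantities ×ˢ (Finset.univ : Finset F)).image fun y =>
      (X y ^ 2 - X y : MvPolynomial (Quantity V C.size × F) F)).card ≤
      3 * Fintype.card F * C.size ^ 2 := by
    refine Finset.card_image_le.trans ?_
    rw [Finset.card_product, Finset.card_univ]
    refine (Nat.mul_le_mul_right _ C.card_quantities_le).trans (le_of_eq ?_)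
    ring
  have h₄ : (insert ((C.operand C.out).bit 0 - 1)
      ((Finset.univ.erase 0).image fun j => (C.operand C.out).bit j)).card ≤
      (Fintype.card F + 1) * C.size ^ 2 := by
    refine (Finset.card_insert_le _ _).trans ?_
    refine (Nat.add_le_add_right (Finset.card_image_le.trans (Finset.card_le_univ _)) 1).trans ?_
    exact Nat.le_mul_of_pos_right _ (hs.trans hs')
  rw [scnf]
  refine Finset.card_image_le.trans ?_
  rw [cnf]
  refine (Finset.card_union_le _ _).trans ?_
  rw [add_mul _ (Fintype.card F + 1)]
  refine Nat.add_le_add ((Finset.card_union_le _ _).trans ?_) h₄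
  rw [add_mul _ (3 * Fintype.card F)]
  refine Nat.add_le_add ((Finset.card_union_le _ _).trans ?_) h₃
  rw [add_mul]
  exact Nat.add_le_add h₁ h₂

/-- All equations of the semi-CNF encoding have short proofs. -/
theorem exists_provable_scnf (F : Type u) [Field F] [Fintype F] :
    ∃ K : ℕ, ∀ (V : Type v) (C : Circuit F V) (T : TruthTables F) (A : Set (MvPolynomial V F)),
      C.fieldAxioms ⊆ A → C.poly ∈ A → ∀ p ∈ C.scnf T,
        Provable A p (K * C.size ^ 2) (K * (C.depth + 1)) := by
  classical
  obtain ⟨K₁, h₁⟩ := exists_provable_exactlyOne.{u, v} (F := F)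
  obtain ⟨K₂, h₂⟩ := exists_provable_step.{u, v} (F := F) (k := 1)
    (fun a : F => MvPolynomial.C a * X 0)
  obtain ⟨K₃, h₃⟩ := exists_provable_step.{u, v} (F := F) (k := 2)
    (fun p : F × F => MvPolynomial.C p.1 * X 0 + MvPolynomial.C p.2 * X 1)
  obtain ⟨K₄, h₄⟩ := exists_provable_step.{u, v} (F := F) (k := 2)
    (fun p : F × F => (MvPolynomial.C p.1 * X 0) * (MvPolynomial.C p.2 * X 1))
  obtain ⟨K₅, h₅⟩ := exists_provable_boolean.{u, v} (F := F)
  obtain ⟨K₆, h₆⟩ := exists_provable_output.{u, v} (F := F)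
  refine ⟨K₁ + K₂ + K₃ + K₄ + K₅ + K₆, fun V C T A hA hC p hp => ?_⟩
  have mono : ∀ K ≤ K₁ + K₂ + K₃ + K₄ + K₅ + K₆,
      Provable A p (K * C.size ^ 2) (K * (C.depth + 1)) →
      Provable A p ((K₁ + K₂ + K₃ + K₄ + K₅ + K₆) * C.size ^ 2)
        ((K₁ + K₂ + K₃ + K₄ + K₅ + K₆) * (C.depth + 1)) := fun K hK h =>
    h.mono (Nat.mul_le_mul_right _ hK) (Nat.mul_le_mul_right _ hK)
  rw [scnf] at hp
  obtain ⟨r, hr, rfl⟩ := Finset.mem_image.1 hp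
  rw [cnf, Finset.mem_union, Finset.mem_union, Finset.mem_union] at hr
  rcases hr with ((hr | hr) | hr) | hr
  · obtain ⟨x, hx, hr⟩ := Finset.mem_biUnion.1 hr
    obtain ⟨c, hc, rfl⟩ := Finset.mem_image.1 hr
    exact mono K₁ (by omega) (h₁ V C A hA x hx c hc)
  · obtain ⟨g, -, hr⟩ := Finset.mem_biUnion.1 hr
    obtain ⟨s, hs, hr⟩ := Finset.mem_biUnion.1 hr
    obtain ⟨c, hc, hcr⟩ := Finset.mem_image.1 hr
    obtain rfl : r = CNF.clausePoly (fun y => (y.1.elim s.res s.arg).bit y.2) c := by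
      rw [← hcr]
      congr 1
      funext ⟨y, j⟩
      cases y <;> rfl
    rcases C.isStep_of_mem_steps g s (List.mem_toFinset.1 hs) with
      ⟨a, u, res, rfl, hu, hres⟩ | ⟨a, b, u, v, res, rfl, hu, hv, hres⟩ |
      ⟨a, b, u, v, res, rfl, hu, hv, hres⟩
    · exact mono K₂ (by omega) (h₂ a V C A hA _ (fun t => by simp) _ (T.correct _) c hc ![u] res
        (by simpa [Fin.forall_fin_succ] using hu) (by simpa [algebraMap_eq] using hres))
    · exact mono K₃ (by omega) (h₃ (a, b) V C A hA _ (fun t => by simp) _ (T.correct _) c hc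
        ![u, v] res (by simpa [Fin.forall_fin_succ] using ⟨hu, hv⟩)
        (by simpa [algebraMap_eq] using hres))
    · exact mono K₄ (by omega) (h₄ (a, b) V C A hA _ (fun t => by simp) _ (T.correct _) c hc
        ![u, v] res (by simpa [Fin.forall_fin_succ] using ⟨hu, hv⟩)
        (by simpa [algebraMap_eq] using hres))
  · obtain ⟨⟨x, j⟩, hx, rfl⟩ := Finset.mem_image.1 hr
    exact mono K₅ (by omega)
      (h₅ V C A hA x (C.isProper_of_mem_quantities (Finset.mem_product.1 hx).1) j)
  · rcases Finset.mem_insert.1 hr with rfl | hr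
    · exact mono K₆ (by omega) (h₆ V C A hA hC).1
    · obtain ⟨j, hj, rfl⟩ := Finset.mem_image.1 hr
      exact mono K₆ (by omega) ((h₆ V C A hA hC).2 j (Finset.ne_of_mem_erase hj))

theorem ubit_poly_sub_one_mem_scnf [Fintype F] (C : Circuit F V) (T : TruthTables F) :
    ubit 0 C.poly - 1 ∈ C.scnf T := by
  classical
  rw [scnf]
  refine Finset.mem_image.2 ⟨(C.operand C.out).bit 0 - 1, ?_, ?_⟩
  · rw [cnf]
    exact Finset.mem_union_right _ (Finset.mem_insert_self _ _)
  · rw [map_sub, map_one]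
    exact congrArg (· - 1) ((C.bitSubst_bit _ 0).trans (by rw [C.operandPoly_operand, poly]))

end Circuit

end

end AlgIPS

theorem mainTheorem6 (F : Type u) [Field F] [Fintype F] :
    ∃ c : ℕ, ∀ (V : Type v) (C : AlgIPS.Circuit F V) (T : AlgIPS.TruthTables F),
      AlgIPS.IPSAlgDerives (C.fieldAxioms ∪ {C.poly}) (C.scnf T)
        (c * C.size ^ c) (c * (C.depth + 1)) ∧
      AlgIPS.IPSAlgDerives (C.fieldAxioms ∪ (C.scnf T : Set (MvPolynomial V F))) {C.poly}
        (c * C.size ^ c) (c * (C.depth + 1)) := by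
  obtain ⟨M, hM⟩ := AlgIPS.Circuit.exists_card_scnf_le.{u, v} F
  obtain ⟨K₁, h₁⟩ := AlgIPS.Circuit.exists_provable_scnf.{u, v} F
  obtain ⟨K₂, h₂⟩ := AlgIPS.exists_provable_poly.{u, v} (F := F)
  -- Quadratically many equations with proofs of quadratic size give `M * K₁ * s ^ 4`. The summand
  -- `4` makes the exponent large enough.
  refine ⟨M * K₁ + K₁ + K₂ + 4, fun V C T => ⟨?_, ?_⟩⟩
  · refine AlgIPS.ipsAlgDerives_of_provable (N := K₁ * C.size ^ 2) (fun p hp =>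
      (h₁ V C T _ Set.subset_union_left (Set.mem_union_right _ (Set.mem_singleton _)) p hp).mono le_rfl
        (Nat.mul_le_mul_right _ (by omega))) ?_
    calc (C.scnf T).card * (K₁ * C.size ^ 2)
        ≤ (M * C.size ^ 2) * (K₁ * C.size ^ 2) := Nat.mul_le_mul_right _ (hM V C T)
      _ = (M * K₁) * C.size ^ 4 := by ring
      _ ≤ _ := Nat.mul_le_mul (by omega) (Nat.pow_le_pow_right C.size_pos (by omega))
  · refine AlgIPS.ipsAlgDerives_of_provable (N := K₂ * C.size ^ 2) (fun p hp => ?_) ?_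
    · rw [Finset.mem_singleton.1 hp]
      exact (h₂ V C _ Set.subset_union_left
        (Or.inr (Finset.mem_coe.2 (C.ubit_poly_sub_one_mem_scnf T)))).mono le_rfl
        (Nat.mul_le_mul_right _ (by omega))
    · rw [Finset.card_singleton, one_mul]
      exact Nat.mul_le_mul (by omega) (Nat.pow_le_pow_right C.size_pos (by omega))
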